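/- Let $n$ be a natural number and $\mathcal E$ a complex Hilbert space. Let $H^2_{\mathcal E}(\mathbb D^n)$ be the Hardy space of functions $\sum_{k\in\mathbb N^n} a_k z^k$ on the unit polydisc with $a_k\in\mathcal E$ and $\sum\|a_k\|^2<\infty$, identified through boundary functions with a closed subspace of $L^2_{\mathcal E}(\mathbb T^n)$. For $\Phi\in L^\infty_{\mathcal B(\mathcal E)}(\mathbb T^n)$ let $T_\Phi=P\,L_\Phi|_{H^2_{\mathcal E}(\mathbb D^n)}$ be the Toeplitz operator with symbol $\Phi$, where $L_\Phi$ is multiplication by $\Phi$ on $L^2_{\mathcal E}(\mathbb T^n)$ and $P$ is the orthogonal projection onto $H^2_{\mathcal E}(\mathbb D^n)$. For a Hilbert space $\mathcal F$ and a bounded analytic function $\Theta\in H^\infty_{\mathcal B(\mathcal F,\mathcal E)}(\mathbb D^n)$ let $M_\Theta:H^2_{\mathcal F}(\mathbb D^n)\to H^2_{\mathcal E}(\mathbb D^n)$ be multiplication by $\Theta$; $\Theta$ is called inner if its radial boundary values (strong limits) are isometries $\mathcal F\to\mathcal E$ almost everywhere on $\mathbb T^n$ (if $\mathcal F$ is not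 separable: for every $x\in\mathcal F$, $\lim_{r\to1^-}\Theta(r\zeta)x$ exists and has norm $\|x\|$ for almost every $\zeta\in\mathbb T^n$). For $1\le k\le n$, $\Theta_k(z)$ denotes $\Theta(z)$ with the $k$-th coordinate of $z$ replaced by $0$. Suppose that $T_\Phi$ is non-constant, i.e. $\Phi$ is not almost everywhere equal to a constant operator. Then $T_\Phi$ is a partial isometry (an isometry on the orthogonal complement of its kernel) if and only if there exist a Hilbert space $\mathcal F$ and inner functions $\Gamma,\Psi\in H^\infty_{\mathcal B(\mathcal F,\mathcal E)}(\mathbb D^n)$ such that $T_\Phi=M_\Gamma M_\Psi^*$ and $$\big(\Gamma(\lambda)-\Gamma_k(\lambda)\big)\big(\Psi(\mu)-\Psi_k(\mu)\big)^*=0\qquad\text{for all }\lambda,\mu\in\mathbb D^n,\ k\in\{1,\dots,n\}.\tag{$*$}$$ Moreover, whenever $T_\Phi=M_\Gamma M_\Psi^*$ with $\mathcal F$ a Hilbert space and $\Gamma,\Psi\in H^\infty_{\mathcal B(\mathcal F,\mathcal E)}(\mathbb D^n)$ inner, condition $(*)$ holds; so $(*)$ may equivalently be left out of the characterization. -/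

import Mathlib

open MeasureTheory Filter Topology
open scoped ENNReal ComplexConjugate

universe u

noncomputable section

namespace PolydiscToeplitz

/-- The open unit polydisc `𝔻ⁿ`. -/
def polydisc (n : ℕ) : Set (Fin n → ℂ) := {z | ∀ i, ‖z i‖ < 1}

/-- The monomial `z ^ k = z₁ ^ k₁ ⋯ zₙ ^ kₙ`. -/
def mono {n : ℕ} (k : Fin n → ℕ) (z : Fin n → ℂ) : ℂ := ∏ i, z i ^ k i

/-- The torus `𝕋ⁿ`, parametrized by angles in `(ℝ / ℤ)ⁿ`. -/
abbrev Torus (n : ℕ) : Type := Fin n → AddCircle (1 : ℝ)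

/-- The normalized Lebesgue measure on the torus. -/
abbrev torusMeasure (n : ℕ) : Measure (Torus n) := Measure.pi fun _ => AddCircle.haarAddCircle

/-- The point `(exp (2πi t₁), …, exp (2πi tₙ))` of `𝕋ⁿ ⊆ ℂⁿ` with angles `t`. -/
def torusPt {n : ℕ} (t : Torus n) : Fin n → ℂ := fun i => (AddCircle.toCircle (t i) : ℂ)

/-- `L²_E(𝕋ⁿ)`. -/
abbrev L2 (n : ℕ) (E : Type*) [NormedAddCommGroup E] : Type _ := Lp E 2 (torusMeasure n)

/-- The Hardy space `H²_E(𝔻ⁿ)`: an element is a power series `∑ aₖ zᵏ` with coefficients in `E`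
and `∑ ‖aₖ‖² < ∞`; it is stored through its coefficients, with the `ℓ²` norm. -/
abbrev H2 (n : ℕ) (E : Type*) [NormedAddCommGroup E] : Type _ := lp (fun _ : Fin n → ℕ => E) 2

section basic

variable {n : ℕ}

lemma mono_add (k l : Fin n → ℕ) (z : Fin n → ℂ) : mono (k + l) z = mono k z * mono l z := by
  simp [mono, pow_add, Finset.prod_mul_distrib]

lemma norm_mono_torusPt (k : Fin n → ℕ) (t : Torus n) : ‖mono k (torusPt t)‖ = 1 := by
  simp only [mono, torusPt, norm_prod, norm_pow]
  exact Finset.prod_eq_one fun i _ => by rw [Circle.norm_coe, one_pow]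

lemma mono_smul (k : Fin n → ℕ) (r : ℝ) (z : Fin n → ℂ) :
    mono k (r • z) = (r : ℂ) ^ (∑ i, k i) * mono k z := by
  simp [mono, mul_pow, Finset.prod_mul_distrib, Finset.prod_pow_eq_pow_sum]

lemma smul_torusPt_mem {r : ℝ} (h0 : 0 ≤ r) (h1 : r < 1) (t : Torus n) :
    r • torusPt t ∈ polydisc n := by
  intro i
  change ‖r • (AddCircle.toCircle (t i) : ℂ)‖ < 1
  rw [norm_smul, Circle.norm_coe, mul_one, Real.norm_of_nonneg h0]
  exact h1

lemma continuous_mono_torusPt (k : Fin n → ℕ) : Continuous fun t : Torus n => mono k (torusPt t) := by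
  unfold mono torusPt
  refine continuous_finsetProd _ fun i _ => Continuous.pow ?_ _
  exact continuous_subtype_val.comp (AddCircle.continuous_toCircle.comp (continuous_apply i))

lemma summable_norm_mono {z : Fin n → ℂ} (hz : z ∈ polydisc n) :
    Summable fun k : Fin n → ℕ => ‖mono k z‖ := by
  refine summable_of_sum_le (c := ∏ i, (1 - ‖z i‖)⁻¹) (fun _ => norm_nonneg _) fun S => ?_
  obtain ⟨N, hN⟩ : ∃ N : ℕ, ∀ k ∈ S, ∀ i, k i < N := by
    refine ⟨(S.sup fun k => Finset.univ.sup k) + 1, fun k hk i => Nat.lt_succ_of_le ?_⟩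
    exact (Finset.le_sup (f := k) (Finset.mem_univ i)).trans
      (Finset.le_sup (f := fun k : Fin n → ℕ => Finset.univ.sup k) hk)
  calc ∑ k ∈ S, ‖mono k z‖ ≤ ∑ k ∈ Fintype.piFinset fun _ : Fin n => Finset.range N, ‖mono k z‖ := by
        refine Finset.sum_le_sum_of_subset_of_nonneg ?_ fun _ _ _ => norm_nonneg _
        intro k hk
        simpa using hN k hk
    _ = ∏ i, ∑ j ∈ Finset.range N, ‖z i‖ ^ j := by
        rw [Finset.prod_univ_sum]
        simp [mono]
    _ ≤ ∏ i, (1 - ‖z i‖)⁻¹ := by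
        refine Finset.prod_le_prod (fun i _ => by positivity) fun i _ => ?_
        rw [← tsum_geometric_of_lt_one (norm_nonneg _) (hz i)]
        exact (summable_geometric_of_lt_one (norm_nonneg _) (hz i)).sum_le_tsum _
          fun _ _ => by positivity

end basic

section hardy

variable {n : ℕ} {E : Type*} [NormedAddCommGroup E] [InnerProductSpace ℂ E]

/-- The value at `z` of the function `∑ aₖ zᵏ` in `H²_E(𝔻ⁿ)`. -/
def H2.eval (f : H2 n E) (z : Fin n → ℂ) : E := ∑' k, mono k z • f k

/-- The continuous function `ζ ↦ ζᵏ x` on the torus. -/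
def monoC (k : Fin n → ℕ) (x : E) : C(Torus n, E) where
  toFun t := mono k (torusPt t) • x
  continuous_toFun := (continuous_mono_torusPt k).smul continuous_const

lemma mono_torusPt_eq_mFourier (k : Fin n → ℕ) (t : Torus n) :
    mono k (torusPt t) = UnitAddTorus.mFourier (fun i => (k i : ℤ)) t := by
  simp [mono, torusPt, UnitAddTorus.mFourier, fourier_apply, AddCircle.toCircle_nsmul]

lemma inner_toLp_monoC (k l : Fin n → ℕ) (x y : E) :
    inner ℂ (ContinuousMap.toLp 2 (torusMeasure n) ℂ (monoC k x))
      (ContinuousMap.toLp 2 (torusMeasure n) ℂ (monoC l y)) =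
      if k = l then inner ℂ x y else 0 := by
  have h := orthonormal_iff_ite.1 (UnitAddTorus.orthonormal_mFourier (d := Fin n))
    (fun i => (k i : ℤ)) (fun i => (l i : ℤ))
  rw [MeasureTheory.ContinuousMap.inner_toLp] at h
  have h0 : inner ℂ (ContinuousMap.toLp 2 (torusMeasure n) ℂ (monoC k x))
      (ContinuousMap.toLp 2 (torusMeasure n) ℂ (monoC l y)) =
      ∫ t, inner ℂ (monoC k x t) (monoC l y t) ∂torusMeasure n := by
    rw [MeasureTheory.L2.inner_def]
    refine integral_congr_ae ?_
    filter_upwards [ContinuousMap.coeFn_toLp (p := 2) (𝕜 := ℂ) (torusMeasure n) (monoC k x),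
      ContinuousMap.coeFn_toLp (p := 2) (𝕜 := ℂ) (torusMeasure n) (monoC l y)] with t h1 h2
    rw [h1, h2]
  rw [h0]
  have e : ∀ t, inner ℂ (monoC k x t) (monoC l y t) =
      (UnitAddTorus.mFourier (fun i => (l i : ℤ)) t *
        conj (UnitAddTorus.mFourier (fun i => (k i : ℤ)) t)) * inner ℂ x y := by
    intro t
    simp only [monoC, ContinuousMap.coe_mk, inner_smul_left, inner_smul_right,
      mono_torusPt_eq_mFourier]
    ring
  simp_rw [e]
  rw [integral_mul_const]
  have hkl : ((fun i => (k i : ℤ)) = fun i => (l i : ℤ)) ↔ k = l := by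
    simp [funext_iff]
  simp only [hkl] at h
  refine (congrArg (· * inner ℂ x y) h).trans ?_
  split_ifs <;> simp

/-- The isometric embedding `x ↦ ζᵏ x` of `E` into `L²_E(𝕋ⁿ)`. -/
def monoL2 (k : Fin n → ℕ) : E →ₗᵢ[ℂ] L2 n E where
  toFun x := ContinuousMap.toLp 2 (torusMeasure n) ℂ (monoC k x)
  map_add' x y := by
    rw [← map_add]; congr 1; ext t; simp [monoC]
  map_smul' c x := by
    simp only [RingHom.id_apply]
    rw [← map_smul]; congr 1; ext t; simp [monoC, smul_comm c]
  norm_map' x := by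
    simp only [LinearMap.coe_mk, AddHom.coe_mk]
    have h := inner_toLp_monoC k k x x
    rw [if_pos rfl, inner_self_eq_norm_sq_to_K, inner_self_eq_norm_sq_to_K] at h
    have h' : ‖ContinuousMap.toLp 2 (torusMeasure n) ℂ (monoC k x)‖ ^ 2 = ‖x‖ ^ 2 := by
      exact_mod_cast h
    exact (sq_eq_sq₀ (norm_nonneg _) (norm_nonneg _)).1 h'

lemma orthogonalFamily_monoL2 :
    OrthogonalFamily ℂ (fun _ : Fin n → ℕ => E) (monoL2 (n := n) (E := E)) := by
  intro k l hkl x y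
  exact (inner_toLp_monoC k l x y).trans (if_neg hkl)

variable [CompleteSpace E]

/-- The identification of `H²_E(𝔻ⁿ)` with the Hardy space `H²_E(𝕋ⁿ) ⊆ L²_E(𝕋ⁿ)`: the function
`∑ aₖ zᵏ` goes to its boundary function, the `L²` sum `∑ ζᵏ aₖ`. -/
def H2.boundary (n : ℕ) (E : Type*) [NormedAddCommGroup E] [InnerProductSpace ℂ E]
    [CompleteSpace E] : H2 n E →ₗᵢ[ℂ] L2 n E :=
  (orthogonalFamily_monoL2 (n := n) (E := E)).linearIsometry

lemma H2.boundary_ae_eq {g : H2 n E} (hg : Summable fun k => ‖g k‖) :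
    H2.boundary n E g =ᵐ[torusMeasure n] fun t => ∑' k, mono k (torusPt t) • g k := by
  have hs : Summable fun k => monoC (n := n) k (g k) := by
    refine Summable.of_norm_bounded hg fun k => ?_
    refine (ContinuousMap.norm_le _ (norm_nonneg _)).2 fun t => ?_
    simp [monoC, norm_smul, norm_mono_torusPt]
  have h1 : HasSum (fun k => monoL2 k (g k)) (H2.boundary n E g) :=
    (orthogonalFamily_monoL2 (n := n) (E := E)).hasSum_linearIsometry g
  have h2 := (ContinuousMap.toLp (E := E) 2 (torusMeasure n) ℂ).hasSum hs.hasSum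
  rw [h1.unique h2]
  filter_upwards [ContinuousMap.coeFn_toLp (p := 2) (𝕜 := ℂ) (torusMeasure n)
    (∑' k, monoC (n := n) k (g k))] with t ht
  rw [ht]
  exact (ContinuousMap.tsum_apply hs t).symm

end hardy

lemma H2.summable_norm {n : ℕ} {E : Type*} [NormedAddCommGroup E] (f : H2 n E)
    {z : Fin n → ℂ} (hz : z ∈ polydisc n) :
    Summable fun k => ‖mono k z‖ * ‖f k‖ := by
  refine Summable.of_nonneg_of_le (fun k => by positivity) (fun k => ?_)
    ((summable_norm_mono hz).mul_right ‖f‖)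
  exact mul_le_mul_of_nonneg_left (lp.norm_apply_le_norm (by norm_num) f k) (norm_nonneg _)

section symbols

/-- `L^∞_{B(E)}(𝕋ⁿ)`: essentially bounded, strongly measurable operator-valued functions on the
torus (measurable in the strong operator topology). -/
structure LInfty (n : ℕ) (E : Type*) [NormedAddCommGroup E] [InnerProductSpace ℂ E] where
  toFun : Torus n → E →L[ℂ] E
  aestronglyMeasurable' : ∀ x, AEStronglyMeasurable (fun t => toFun t x) (torusMeasure n)
  bounded' : ∃ C : ℝ, ∀ᵐ t ∂torusMeasure n, ‖toFun t‖ ≤ C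

instance {n : ℕ} {E : Type*} [NormedAddCommGroup E] [InnerProductSpace ℂ E] :
    CoeFun (LInfty n E) fun _ => Torus n → E →L[ℂ] E := ⟨LInfty.toFun⟩

/-- `H^∞_{B(F,E)}(𝔻ⁿ)`: bounded analytic `B(F,E)`-valued functions on the polydisc. An element is a
power series `∑ Aₖ zᵏ` with coefficients in `B(F,E)` that converges at every point of `𝔻ⁿ`
(that is, an analytic function on `𝔻ⁿ`), with bounded sum. -/
structure HInfty (n : ℕ) (F E : Type*) [NormedAddCommGroup F] [InnerProductSpace ℂ F]
    [NormedAddCommGroup E] [InnerProductSpace ℂ E] where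
  coeff : (Fin n → ℕ) → F →L[ℂ] E
  summable' : ∀ z ∈ polydisc n, Summable fun k => mono k z • coeff k
  bounded' : ∃ C : ℝ, ∀ z ∈ polydisc n, ‖∑' k, mono k z • coeff k‖ ≤ C

variable {n : ℕ} {F E : Type*} [NormedAddCommGroup F] [InnerProductSpace ℂ F]
  [NormedAddCommGroup E] [InnerProductSpace ℂ E]

/-- The value `Θ(z) = ∑ Aₖ zᵏ`. -/
def HInfty.eval (Θ : HInfty n F E) (z : Fin n → ℂ) : F →L[ℂ] E := ∑' k, mono k z • Θ.coeff k

instance : CoeFun (HInfty n F E) fun _ => (Fin n → ℂ) → F →L[ℂ] E := ⟨HInfty.eval⟩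

/-- `Θ` is inner: its radial boundary values `lim_{r → 1} Θ(rζ)` (strong limits) are isometries for
almost every `ζ ∈ 𝕋ⁿ`. For an arbitrary, possibly non-separable, `F` the exceptional null set may
depend on the vector `x ∈ F`; for separable `F` it need not, see `HInfty.isInner_iff`. -/
def HInfty.IsInner (Θ : HInfty n F E) : Prop :=
  ∀ x : F, ∀ᵐ t ∂torusMeasure n, ∃ y : E,
    Tendsto (fun r : ℝ => Θ (r • torusPt t) x) (𝓝[<] 1) (𝓝 y) ∧ ‖y‖ = ‖x‖

/-- `T` is a partial isometry: it is isometric on the orthogonal complement of its kernel. -/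
def IsPartialIsometry {H : Type*} [NormedAddCommGroup H] [InnerProductSpace ℂ H]
    (T : H →L[ℂ] H) : Prop :=
  ∀ x ∈ (LinearMap.ker (T : H →ₗ[ℂ] H))ᗮ, ‖T x‖ = ‖x‖

/-- The symbol `Φ` is constant (almost everywhere). -/
def LInfty.IsConstant (Φ : LInfty n E) : Prop :=
  ∃ A : E →L[ℂ] E, ∀ᵐ t ∂torusMeasure n, Φ t = A

end symbols

section inner

variable {n : ℕ} {F E : Type*} [NormedAddCommGroup F] [InnerProductSpace ℂ F]
  [NormedAddCommGroup E] [InnerProductSpace ℂ E]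

/-- For separable `F`, inner functions are those whose strong radial limit exists and is a linear
isometry at almost every point of the torus. -/
lemma HInfty.isInner_iff [CompleteSpace E] [TopologicalSpace.SeparableSpace F]
    (Θ : HInfty n F E) :
    Θ.IsInner ↔ ∀ᵐ t ∂torusMeasure n, ∃ V : F →ₗᵢ[ℂ] E, ∀ x,
      Tendsto (fun r : ℝ => Θ (r • torusPt t) x) (𝓝[<] 1) (𝓝 (V x)) := by
  constructor
  · intro h
    obtain ⟨C, hC⟩ := Θ.bounded'
    have h' := ae_all_iff.2 fun j : ℕ => h (TopologicalSpace.denseSeq F j)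
    filter_upwards [h'] with t ht
    have hbd : ∀ᶠ r : ℝ in 𝓝[<] 1, ∀ x, ‖Θ (r • torusPt t) x‖ ≤ C * ‖x‖ := by
      filter_upwards [Ioo_mem_nhdsLT (show (0 : ℝ) < 1 by norm_num)] with r hr x
      exact (Θ (r • torusPt t)).le_of_opNorm_le (hC _ (smul_torusPt_mem hr.1.le hr.2 t)) x
    have hC0 : 0 ≤ C := (norm_nonneg _).trans (hC 0 fun i => by simp)
    have key : ∀ x, ∃ y, Tendsto (fun r : ℝ => Θ (r • torusPt t) x) (𝓝[<] 1) (𝓝 y) := by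
      intro x
      refine cauchy_map_iff_exists_tendsto.1 ?_
      refine Metric.cauchy_iff.2 ⟨inferInstance, fun ε hε => ?_⟩
      obtain ⟨j, hj⟩ := (TopologicalSpace.denseRange_denseSeq F).exists_dist_lt x
        (show 0 < ε / (4 * (C + 1)) by positivity)
      obtain ⟨y, hy, -⟩ := ht j
      refine ⟨_, image_mem_map ((hy.eventually (Metric.ball_mem_nhds y
        (show 0 < ε / 4 by positivity))).and hbd), ?_⟩
      have small : ∀ r : ℝ, (∀ x, ‖Θ (r • torusPt t) x‖ ≤ C * ‖x‖) →
          dist (Θ (r • torusPt t) x)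
            (Θ (r • torusPt t) (TopologicalSpace.denseSeq F j)) < ε / 4 := by
        intro r hr
        rw [dist_eq_norm, ← map_sub]
        refine (hr _).trans_lt ?_
        rw [dist_eq_norm, lt_div_iff₀ (by positivity)] at hj
        nlinarith [norm_nonneg (x - TopologicalSpace.denseSeq F j)]
      rintro _ ⟨r, ⟨hr1, hr2⟩, rfl⟩ _ ⟨s, ⟨hs1, hs2⟩, rfl⟩
      have e1 := small r hr2
      have e2 := small s hs2
      have d1 := dist_triangle4 (Θ (r • torusPt t) x)
        (Θ (r • torusPt t) (TopologicalSpace.denseSeq F j))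
        (Θ (s • torusPt t) (TopologicalSpace.denseSeq F j)) (Θ (s • torusPt t) x)
      have d2 := dist_triangle_right (Θ (r • torusPt t) (TopologicalSpace.denseSeq F j))
        (Θ (s • torusPt t) (TopologicalSpace.denseSeq F j)) y
      change dist _ _ < _ at hr1 hs1
      change dist (Θ (r • torusPt t) x) (Θ (s • torusPt t) x) < ε
      rw [dist_comm] at e2
      linarith
    choose V hV using key
    have hV1 : ∀ x, ‖V x‖ ≤ C * ‖x‖ := fun x =>
      le_of_tendsto (hV x).norm (hbd.mono fun r hr => hr x)
    let V' : F →ₗ[ℂ] E :=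
      { toFun := V
        map_add' := fun x y => tendsto_nhds_unique (hV (x + y))
          (by simpa using (hV x).add (hV y))
        map_smul' := fun c x => tendsto_nhds_unique (hV (c • x))
          (by simpa using (hV x).const_smul c) }
    have hcont : Continuous V := (V'.mkContinuous C hV1).continuous
    have hn : (fun x => ‖V x‖) = fun x => ‖x‖ := by
      refine (TopologicalSpace.denseRange_denseSeq F).equalizer hcont.norm continuous_norm ?_
      funext j
      obtain ⟨y, hy, hy'⟩ := ht j
      simpa [tendsto_nhds_unique (hV _) hy] using hy'
    exact ⟨⟨V', fun x => congrFun hn x⟩, hV⟩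
  · intro h x
    filter_upwards [h] with t ht
    obtain ⟨V, hV⟩ := ht
    exact ⟨V x, hV x, V.norm_map x⟩

end inner

section laurent

variable {n : ℕ} {E : Type*} [NormedAddCommGroup E] [InnerProductSpace ℂ E]

lemma LInfty.aestronglyMeasurable_apply (Φ : LInfty n E) {f : Torus n → E}
    (hf : AEStronglyMeasurable f (torusMeasure n)) :
    AEStronglyMeasurable (fun t => Φ t (f t)) (torusMeasure n) := by
  obtain ⟨g, hg, hfg⟩ := hf
  have hs : ∀ s : SimpleFunc (Torus n) E,
      AEStronglyMeasurable (fun t => Φ t (s t)) (torusMeasure n) := by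
    intro s
    induction s using SimpleFunc.induction with
    | const c hS =>
      refine ((Φ.aestronglyMeasurable' c).indicator hS).congr (Eventually.of_forall fun t => ?_)
      simp only [SimpleFunc.coe_piecewise, SimpleFunc.coe_const, Set.indicator, Set.piecewise]
      split_ifs <;> simp
    | add _ h1 h2 =>
      refine (h1.add h2).congr (Eventually.of_forall fun t => ?_)
      simp
  refine (aestronglyMeasurable_of_tendsto_ae (f := fun j t => Φ t (hg.approx j t))
    (g := fun t => Φ t (g t)) atTop (fun j => hs _)
    (Eventually.of_forall fun t => ?_)).congr ?_
  · exact ((Φ t).continuous.tendsto _).comp (hg.tendsto_approx t)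
  · filter_upwards [hfg] with t ht
    rw [ht]

lemma LInfty.memLp_apply (Φ : LInfty n E) (f : L2 n E) :
    MemLp (fun t => Φ t (f t)) 2 (torusMeasure n) := by
  obtain ⟨C, hC⟩ := Φ.bounded'
  refine (Lp.memLp f).of_le_mul (c := C)
    (Φ.aestronglyMeasurable_apply (Lp.aestronglyMeasurable f)) ?_
  filter_upwards [hC] with t ht
  exact (Φ t).le_of_opNorm_le ht _

/-- The Laurent operator `L_Φ f = Φ f` on `L²_E(𝕋ⁿ)`. -/
def LInfty.laurent (Φ : LInfty n E) : L2 n E →L[ℂ] L2 n E :=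
  LinearMap.mkContinuousOfExistsBound
    { toFun := fun f => (Φ.memLp_apply f).toLp _
      map_add' := fun f g => by
        rw [← MemLp.toLp_add, MemLp.toLp_eq_toLp_iff]
        filter_upwards [Lp.coeFn_add f g] with t ht
        rw [ht]
        exact map_add (Φ t) _ _
      map_smul' := fun c f => by
        rw [RingHom.id_apply, ← MemLp.toLp_const_smul, MemLp.toLp_eq_toLp_iff]
        filter_upwards [Lp.coeFn_smul c f] with t ht
        rw [ht]
        exact map_smul (Φ t) _ _ }
    (by
      obtain ⟨C, hC⟩ := Φ.bounded'
      refine ⟨C, fun f => Lp.norm_le_mul_norm_of_ae_le_mul ?_⟩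
      filter_upwards [hC, (Φ.memLp_apply f).coeFn_toLp] with t ht ht'
      simp only [LinearMap.coe_mk, AddHom.coe_mk]
      rw [ht']
      exact (Φ t).le_of_opNorm_le ht _)

lemma LInfty.laurent_ae_eq (Φ : LInfty n E) (f : L2 n E) :
    Φ.laurent f =ᵐ[torusMeasure n] fun t => Φ t (f t) :=
  (Φ.memLp_apply f).coeFn_toLp

/-- The Toeplitz operator `T_Φ = P L_Φ |_{H²}` on `H²_E(𝔻ⁿ)`, where `H²_E(𝔻ⁿ)` sits in `L²_E(𝕋ⁿ)`
through boundary functions and `P`, the adjoint of this embedding, is the orthogonal projection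
onto it. -/
def LInfty.toeplitz [CompleteSpace E] (Φ : LInfty n E) : H2 n E →L[ℂ] H2 n E :=
  (ContinuousLinearMap.adjoint (H2.boundary n E).toContinuousLinearMap) ∘L Φ.laurent ∘L
    (H2.boundary n E).toContinuousLinearMap

end laurent

section multiplication

variable {n : ℕ} {F E : Type*} [NormedAddCommGroup F] [InnerProductSpace ℂ F]
  [NormedAddCommGroup E] [InnerProductSpace ℂ E]

lemma HInfty.summable_norm (Θ : HInfty n F E) {z : Fin n → ℂ} (hz : z ∈ polydisc n) :
    Summable fun k => ‖mono k z‖ * ‖Θ.coeff k‖ := by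
  set w : Fin n → ℂ := fun i => (((‖z i‖ + 1) / 2 : ℝ) : ℂ) with hw
  have hwn : ∀ i, ‖w i‖ = (‖z i‖ + 1) / 2 := fun i => by
    rw [hw, Complex.norm_real, Real.norm_of_nonneg (by positivity)]
  have hwp : ∀ i, 0 < ‖w i‖ := fun i => by rw [hwn]; positivity
  have hwd : w ∈ polydisc n := fun i => by have := hz i; rw [hwn]; linarith
  have hq : (fun i => z i / w i) ∈ polydisc n := fun i => by
    have := hz i
    rw [norm_div, div_lt_one (hwp i), hwn]; linarith
  obtain ⟨C, hC⟩ := ((Θ.summable' w hwd).tendsto_cofinite_zero.norm).bddAbove_range_of_cofinite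
  refine Summable.of_nonneg_of_le (fun k => by positivity) (fun k => ?_)
    ((summable_norm_mono hq).mul_right C)
  have h1 : mono k z = mono k (fun i => z i / w i) * mono k w := by
    simp only [mono, ← Finset.prod_mul_distrib, ← mul_pow]
    refine Finset.prod_congr rfl fun i _ => ?_
    rw [div_mul_cancel₀ _ (norm_pos_iff.1 (hwp i))]
  have h2 : ‖mono k w • Θ.coeff k‖ ≤ C := hC ⟨k, rfl⟩
  rw [norm_smul] at h2
  rw [h1, norm_mul, mul_assoc]
  exact mul_le_mul_of_nonneg_left h2 (norm_nonneg _)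

instance finite_fiber (m : Fin n → ℕ) :
    Finite ((fun p : (Fin n → ℕ) × (Fin n → ℕ) => p.1 + p.2) ⁻¹' {m}) := by
  refine Set.Finite.to_subtype (((Set.finite_Iic m).prod (Set.finite_Iic m)).subset ?_)
  rintro ⟨k, l⟩ h
  have h : k + l = m := h
  exact ⟨fun i => by simp [← h], fun i => by simp [← h]⟩

/-- The `m`-th coefficient `∑_{k + l = m} Aₖ aₗ` of the product of `∑ Aₖ zᵏ` and `∑ aₗ zˡ`. -/
def HInfty.mulCoeff (Θ : HInfty n F E) (f : (Fin n → ℕ) → F) (m : Fin n → ℕ) : E :=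
  ∑' p : ((fun p : (Fin n → ℕ) × (Fin n → ℕ) => p.1 + p.2) ⁻¹' {m}),
    Θ.coeff p.1.1 (f p.1.2)

variable [CompleteSpace E]

lemma HInfty.mulCoeff_hasSum (Θ : HInfty n F E) (f : H2 n F) [CompleteSpace F]
    {z : Fin n → ℂ} (hz : z ∈ polydisc n) :
    (Summable fun m => ‖mono m z • Θ.mulCoeff f m‖) ∧
      HasSum (fun m => mono m z • Θ.mulCoeff f m) (Θ z (f.eval z)) := by
  set G : (Fin n → ℕ) × (Fin n → ℕ) → E :=
    fun p => mono (p.1 + p.2) z • Θ.coeff p.1 (f p.2) with hG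
  have hGs : Summable fun p => ‖G p‖ := by
    refine Summable.of_nonneg_of_le (fun p => norm_nonneg _) (fun p => ?_)
      ((Θ.summable_norm hz).mul_of_nonneg (f.summable_norm hz)
        (fun k => by positivity) (fun k => by positivity))
    rw [hG, norm_smul, mono_add, norm_mul]
    calc ‖mono p.1 z‖ * ‖mono p.2 z‖ * ‖Θ.coeff p.1 (f p.2)‖
        ≤ ‖mono p.1 z‖ * ‖mono p.2 z‖ * (‖Θ.coeff p.1‖ * ‖f p.2‖) := by
          gcongr; exact (Θ.coeff p.1).le_opNorm _
      _ = _ := by ring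
  have hfs : Summable fun k => mono k z • f k :=
    Summable.of_norm (by simpa [norm_smul] using f.summable_norm hz)
  have hval : ∑' p, G p = Θ z (f.eval z) := by
    rw [hGs.of_norm.tsum_prod]
    have e : ∀ k, ∑' l, G (k, l) = (mono k z • Θ.coeff k) (f.eval z) := by
      intro k
      rw [H2.eval, ContinuousLinearMap.map_tsum _ hfs]
      refine tsum_congr fun l => ?_
      simp [hG, mono_add, mul_smul, smul_comm (mono k z)]
    simp_rw [e]
    exact ((ContinuousLinearMap.apply ℂ E (f.eval z)).map_tsum (Θ.summable' z hz)).symm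
  have hterm : ∀ m, ∑' p : ((fun p : (Fin n → ℕ) × (Fin n → ℕ) => p.1 + p.2) ⁻¹' {m}), G p =
      mono m z • Θ.mulCoeff f m := by
    intro m
    rw [HInfty.mulCoeff, ← tsum_const_smul'']
    refine tsum_congr fun p => ?_
    have hp : p.1.1 + p.1.2 = m := p.2
    simp [hG, hp]
  have h1 := hGs.of_norm.hasSum.tsum_fiberwise (fun p => p.1 + p.2)
  have h2 := hGs.hasSum.tsum_fiberwise (fun p => p.1 + p.2)
  simp_rw [hterm] at h1
  rw [hval] at h1
  refine ⟨Summable.of_nonneg_of_le (fun _ => norm_nonneg _) (fun m => ?_) h2.summable, h1⟩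
  rw [← hterm]
  exact norm_tsum_le_tsum_norm Summable.of_finite

lemma HInfty.sum_mulCoeff_le (Θ : HInfty n F E) [CompleteSpace F] {C : ℝ}
    (hC : ∀ z ∈ polydisc n, ‖Θ z‖ ≤ C) (f : H2 n F) (S : Finset (Fin n → ℕ)) :
    ∑ m ∈ S, ‖Θ.mulCoeff f m‖ ^ 2 ≤ (C * ‖f‖) ^ 2 := by
  have hC0 : 0 ≤ C := (norm_nonneg _).trans (hC 0 fun i => by simp)
  have key : ∀ r ∈ Set.Ioo (0 : ℝ) 1,
      ∑ m ∈ S, (r ^ (∑ i, m i) * ‖Θ.mulCoeff f m‖) ^ 2 ≤ (C * ‖f‖) ^ 2 := by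
    intro r hr
    have hd : (fun _ : Fin n => (r : ℂ)) ∈ polydisc n := fun i => by
      simpa [abs_of_pos hr.1] using hr.2
    have hmono : ∀ m : Fin n → ℕ, mono m (fun _ : Fin n => (r : ℂ)) = (r : ℂ) ^ (∑ i, m i) :=
      fun m => by simp [mono, Finset.prod_pow_eq_pow_sum]
    have hm1 : Summable fun m => ‖(r : ℂ) ^ (∑ i, m i) • Θ.mulCoeff f m‖ := by
      simpa only [hmono] using (Θ.mulCoeff_hasSum f hd).1
    have hf1 : Summable fun m => ‖(r : ℂ) ^ (∑ i, m i) • f m‖ := by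
      simpa only [hmono, norm_smul] using f.summable_norm hd
    have mem : ∀ {X : Type _} [NormedAddCommGroup X] (a : (Fin n → ℕ) → X),
        (Summable fun m => ‖a m‖) → Memℓp a 2 := by
      intro X _ a ha
      exact (memℓp_gen (p := 1) (by simpa using ha)).of_exponent_ge (by norm_num)
    have mem' : ∀ (a : (Fin n → ℕ) → F), (Summable fun m => ‖a m‖) → Memℓp a 2 := by
      intro a ha
      exact (memℓp_gen (p := 1) (by simpa using ha)).of_exponent_ge (by norm_num)
    let g : H2 n E := ⟨_, mem _ hm1⟩
    let fr : H2 n F := ⟨_, mem' _ hf1⟩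
    have bg := H2.boundary_ae_eq (g := g) hm1
    have bf := H2.boundary_ae_eq (g := fr) hf1
    have sm : ∀ (m : Fin n → ℕ) (t : Torus n),
        mono m (r • torusPt t) = mono m (torusPt t) * (r : ℂ) ^ (∑ i, m i) :=
      fun m t => by rw [mono_smul, mul_comm]
    have hle : ‖H2.boundary n E g‖ ≤ C * ‖H2.boundary n F fr‖ := by
      refine Lp.norm_le_mul_norm_of_ae_le_mul ?_
      filter_upwards [bg, bf] with t h1 h2
      have hz := smul_torusPt_mem hr.1.le hr.2 t
      have e1 : ∑' k, mono k (torusPt t) • g k = Θ (r • torusPt t) (f.eval (r • torusPt t)) := by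
        rw [← (Θ.mulCoeff_hasSum f hz).2.tsum_eq]
        refine tsum_congr fun m => ?_
        rw [sm, mul_smul]
      have e2 : ∑' k, mono k (torusPt t) • fr k = f.eval (r • torusPt t) := by
        rw [H2.eval]
        refine tsum_congr fun m => ?_
        rw [sm, mul_smul]
      rw [h1, h2, e1, e2]
      exact (Θ _).le_of_opNorm_le (hC _ hz) _
    rw [LinearIsometry.norm_map, LinearIsometry.norm_map] at hle
    have hfr : ‖fr‖ ≤ ‖f‖ := by
      refine lp.norm_mono (by norm_num) fun m => ?_
      change ‖(r : ℂ) ^ (∑ i, m i) • f m‖ ≤ ‖f m‖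
      rw [norm_smul, norm_pow, Complex.norm_real, Real.norm_of_nonneg hr.1.le]
      exact mul_le_of_le_one_left (norm_nonneg _) (pow_le_one₀ hr.1.le hr.2.le)
    have hg := lp.sum_rpow_le_norm_rpow (p := 2) (by norm_num) g S
    simp only [ENNReal.toReal_ofNat, Real.rpow_ofNat] at hg
    have hg' : ∑ m ∈ S, (r ^ (∑ i, m i) * ‖Θ.mulCoeff f m‖) ^ 2 ≤ ‖g‖ ^ 2 := by
      refine le_trans (le_of_eq (Finset.sum_congr rfl fun m _ => ?_)) hg
      change _ = ‖(r : ℂ) ^ (∑ i, m i) • Θ.mulCoeff f m‖ ^ 2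
      rw [norm_smul, norm_pow, Complex.norm_real, Real.norm_of_nonneg hr.1.le]
    refine hg'.trans (pow_le_pow_left₀ (norm_nonneg _) (hle.trans ?_) 2)
    exact mul_le_mul_of_nonneg_left hfr hC0
  have hlim : Tendsto (fun r : ℝ => ∑ m ∈ S, (r ^ (∑ i, m i) * ‖Θ.mulCoeff f m‖) ^ 2) (𝓝[<] 1)
      (𝓝 (∑ m ∈ S, ‖Θ.mulCoeff f m‖ ^ 2)) := by
    have : Continuous fun r : ℝ => ∑ m ∈ S, (r ^ (∑ i, m i) * ‖Θ.mulCoeff f m‖) ^ 2 := by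
      fun_prop
    simpa using (this.tendsto 1).mono_left nhdsWithin_le_nhds
  refine le_of_tendsto hlim ?_
  filter_upwards [Ioo_mem_nhdsLT (show (0 : ℝ) < 1 by norm_num)] with r hr using key r hr

lemma HInfty.memℓp_mulCoeff (Θ : HInfty n F E) [CompleteSpace F] (f : H2 n F) :
    Memℓp (Θ.mulCoeff f) 2 := by
  obtain ⟨C, hC⟩ := Θ.bounded'
  refine memℓp_gen' (C := (C * ‖f‖) ^ 2) fun S => ?_
  simpa using Θ.sum_mulCoeff_le hC f S

/-- The multiplication operator `M_Θ : H²_F(𝔻ⁿ) → H²_E(𝔻ⁿ)`, `(M_Θ f)(z) = Θ(z) f(z)`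
(see `HInfty.eval_mulOp`). -/
def HInfty.mulOp [CompleteSpace F] (Θ : HInfty n F E) : H2 n F →L[ℂ] H2 n E :=
  LinearMap.mkContinuousOfExistsBound
    { toFun := fun f => ⟨Θ.mulCoeff f, Θ.memℓp_mulCoeff f⟩
      map_add' := fun f g => by
        ext m
        change Θ.mulCoeff (f + g) m = Θ.mulCoeff f m + Θ.mulCoeff g m
        simp only [HInfty.mulCoeff]
        rw [← Summable.tsum_add Summable.of_finite Summable.of_finite]
        simp
      map_smul' := fun c f => by
        ext m
        change Θ.mulCoeff (c • f) m = c • Θ.mulCoeff f m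
        simp only [HInfty.mulCoeff]
        rw [← tsum_const_smul'']
        simp }
    (by
      obtain ⟨C, hC⟩ := Θ.bounded'
      have hC0 : 0 ≤ C := (norm_nonneg _).trans (hC 0 fun i => by simp)
      refine ⟨C, fun f => lp.norm_le_of_forall_sum_le (by norm_num) (by positivity) fun S => ?_⟩
      simpa using Θ.sum_mulCoeff_le hC f S)

/-- `(M_Θ f)(z) = Θ(z) f(z)` on the polydisc. -/
lemma HInfty.eval_mulOp [CompleteSpace F] (Θ : HInfty n F E) (f : H2 n F)
    {z : Fin n → ℂ} (hz : z ∈ polydisc n) : (Θ.mulOp f).eval z = Θ z (f.eval z) :=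
  (Θ.mulCoeff_hasSum f hz).2.tsum_eq

/-- The product condition `(Γ(λ) - Γ_k(λ)) (Ψ(μ) - Ψ_k(μ))* = 0` for all `λ, μ ∈ 𝔻ⁿ` and all
coordinates `k`, where the index `k` means that the `k`-th coordinate is replaced by `0`. -/
def ProductCondition [CompleteSpace F] (Γ Ψ : HInfty n F E) : Prop :=
  ∀ lam ∈ polydisc n, ∀ mu ∈ polydisc n, ∀ k : Fin n,
    (Γ lam - Γ (Function.update lam k 0)) ∘L
      ContinuousLinearMap.adjoint (Ψ mu - Ψ (Function.update mu k 0)) = 0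

end multiplication

end PolydiscToeplitz

end

open PolydiscToeplitz

/-! A Toeplitz operator satisfies `M_{z^m}* T M_{z^m} = T`, because monomials are unimodular on the
torus. The forward direction uses only this identity and `T T* T = T`. If `f` lies in the initial
space, that is `T* T f = f`, then `T f`, which has norm `‖f‖`, is the backward shift of `T (z^m f)`,
whose norm is at most `‖f‖`. Hence nothing is lost: `z^m f` is again in the initial space and `T
(z^m f) = z^m T f`. The same applies to `T*`. It follows that the backward shifts compressed to the
initial space doubly commute with the shifts (`proj_shift_bshift`), so this space has a Wold
decomposition in `n` variables. If `W` consists of its vectors killed by all compressed backward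
shifts, it is the orthogonal sum of the spaces `z^m W` (`orthogonalFamily_wandering`,
`inner_eq_zero_of_wandering`). This yields an isometry `A` from the Hardy space over `W` onto the
initial space which commutes with the shifts. So does `G = T A`, and `T = T A A* = G A*`.

An isometry that commutes with the shifts is multiplication by an inner function. Its adjoint maps
the kernel at `z` in direction `y` to the kernel at `z` in direction `Θ(z)* y`, which bounds `Θ` by
1. Radial limits exist by Fatou's theorem on the polydisc, obtained from the disc along the slices
`z ↦ f (z ζ)`. They have norm at most `‖x‖` and mean square `‖x‖²`, so their norm is `‖x‖` almost
everywhere (`isInner_symbol`).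

Conversely, multiplication by an inner function is isometric (`inner_mulOp`), and `G A*` is a
partial isometry whenever `G` and `A` are isometries.

For the product condition, insert between `M_Γ` and `M_Ψ*` the projections onto the functions
divisible by `z_k` and onto those independent of `z_k`. In the Toeplitz identity for the shift by
`z_k`, the divisible part already accounts for the whole of `M_Γ M_Ψ*`, so the other part vanishes.
On reproducing kernels this is the stated identity. -/

noncomputable section

namespace PolydiscToeplitz

/-! ### Shifts, monomials and reproducing kernels on the Hardy space -/

section shift

variable {n : ℕ} {E : Type*} [NormedAddCommGroup E] [InnerProductSpace ℂ E]

omit [InnerProductSpace ℂ E] in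
lemma H2.hasSum_sq (f : H2 n E) : HasSum (fun k => ‖f k‖ ^ 2) (‖f‖ ^ 2) := by
  simpa using lp.hasSum_norm (p := 2) (by norm_num) f

open Classical in
/-- The coefficients of `z ^ m * f`. -/
def shiftCoeff (m : Fin n → ℕ) (f : (Fin n → ℕ) → E) (k : Fin n → ℕ) : E :=
  if m ≤ k then f (k - m) else 0

omit [InnerProductSpace ℂ E] in
@[simp] lemma shiftCoeff_add (m : Fin n → ℕ) (f : (Fin n → ℕ) → E) (k : Fin n → ℕ) :
    shiftCoeff m f (k + m) = f k := by
  simp [shiftCoeff]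

omit [InnerProductSpace ℂ E] in
lemma shiftCoeff_of_not_mem_range (m : Fin n → ℕ) (f : (Fin n → ℕ) → E) {k : Fin n → ℕ}
    (hk : k ∉ Set.range fun l : Fin n → ℕ => l + m) : shiftCoeff m f k = 0 :=
  if_neg fun h => hk ⟨k - m, tsub_add_cancel_of_le h⟩

omit [InnerProductSpace ℂ E] in
lemma hasSum_sq_shiftCoeff (m : Fin n → ℕ) (f : H2 n E) :
    HasSum (fun k => ‖shiftCoeff m f k‖ ^ 2) (‖f‖ ^ 2) := by
  refine ((add_left_injective m).hasSum_iff fun k hk => ?_).1 ?_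
  · rw [shiftCoeff_of_not_mem_range m f hk]; simp
  · simpa [Function.comp_def] using f.hasSum_sq

/-- Multiplication by the monomial `z ^ m` on the Hardy space. -/
def shift (m : Fin n → ℕ) : H2 n E →ₗᵢ[ℂ] H2 n E where
  toFun f := ⟨shiftCoeff m f, memℓp_gen (by simpa using (hasSum_sq_shiftCoeff m f).summable)⟩
  map_add' f g := by
    ext k
    change shiftCoeff m (f + g) k = shiftCoeff m f k + shiftCoeff m g k
    simp only [shiftCoeff]
    split_ifs <;> simp
  map_smul' c f := by
    ext k
    change shiftCoeff m (c • f) k = c • shiftCoeff m f k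
    simp only [shiftCoeff]
    split_ifs <;> simp
  norm_map' f := by
    refine (sq_eq_sq₀ (norm_nonneg _) (norm_nonneg _)).1 ?_
    exact (H2.hasSum_sq _).unique (hasSum_sq_shiftCoeff m f)

open Classical in
lemma shift_apply (m : Fin n → ℕ) (f : H2 n E) (k : Fin n → ℕ) :
    shift m f k = if m ≤ k then f (k - m) else 0 := rfl

@[simp] lemma shift_apply_add (m : Fin n → ℕ) (f : H2 n E) (k : Fin n → ℕ) :
    shift m f (k + m) = f k := shiftCoeff_add m f k

/-- The monomial `z ^ k x` in the Hardy space. -/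
def H2.single (k : Fin n → ℕ) (x : E) : H2 n E := lp.single 2 k x

omit [InnerProductSpace ℂ E] in
@[simp] lemma H2.single_apply_self (k : Fin n → ℕ) (x : E) : H2.single k x k = x :=
  lp.single_apply_self (E := fun _ : Fin n → ℕ => E) 2 k x

omit [InnerProductSpace ℂ E] in
lemma H2.single_apply_ne (k : Fin n → ℕ) (x : E) {l : Fin n → ℕ} (h : l ≠ k) :
    H2.single k x l = 0 :=
  lp.single_apply_ne (E := fun _ : Fin n → ℕ => E) 2 k x h

lemma H2.inner_single_left (k : Fin n → ℕ) (x : E) (f : H2 n E) :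
    inner ℂ (H2.single k x) f = inner ℂ x (f k) :=
  lp.inner_single_left k x f

omit [InnerProductSpace ℂ E] in
@[simp] lemma H2.norm_single (k : Fin n → ℕ) (x : E) : ‖(H2.single k x : H2 n E)‖ = ‖x‖ :=
  lp.norm_single (E := fun _ : Fin n → ℕ => E) (p := 2) (by norm_num) k x

omit [InnerProductSpace ℂ E] in
lemma H2.hasSum_single (f : H2 n E) : HasSum (fun k => H2.single k (f k)) f :=
  lp.hasSum_single (E := fun _ : Fin n → ℕ => E) (p := 2) (by norm_num) f

@[simp] lemma shift_single (m k : Fin n → ℕ) (x : E) :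
    shift m (H2.single k x) = H2.single (k + m) x := by
  ext l
  by_cases h : m ≤ l
  · obtain ⟨l, rfl⟩ : ∃ l', l = l' + m := ⟨l - m, (tsub_add_cancel_of_le h).symm⟩
    rw [shift_apply_add]
    by_cases hl : l = k
    · subst hl; simp
    · rw [H2.single_apply_ne k x hl, H2.single_apply_ne _ x (by simpa using hl)]
  · rw [shift_apply, if_neg h, H2.single_apply_ne]
    rintro rfl
    exact h le_add_self

lemma shift_add (m l : Fin n → ℕ) (f : H2 n E) : shift (m + l) f = shift m (shift l f) := by
  ext k
  by_cases h : m + l ≤ k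
  · obtain ⟨k, rfl⟩ : ∃ k', k = k' + (m + l) := ⟨k - (m + l), (tsub_add_cancel_of_le h).symm⟩
    rw [shift_apply_add, add_comm m l, ← add_assoc, shift_apply_add, shift_apply_add]
  · rw [shift_apply, if_neg h, shift_apply]
    split_ifs with h1
    · rw [shift_apply, if_neg]
      intro h2
      exact h (by rw [add_comm]; exact add_le_of_le_tsub_right_of_le h1 h2)
    · rfl

lemma shift_zero (f : H2 n E) : shift 0 f = f := by
  ext k
  simp [shift_apply]

lemma H2.eval_shift (m : Fin n → ℕ) (f : H2 n E) (z : Fin n → ℂ) :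
    (shift m f).eval z = mono m z • f.eval z := by
  simp only [H2.eval]
  rw [← tsum_const_smul'', ← (add_left_injective m).tsum_eq]
  · refine tsum_congr fun k => ?_
    rw [shift_apply_add, mono_add, mul_comm, mul_smul]
  · intro k hk
    by_contra h
    refine hk ?_
    have : shift m f k = 0 := shiftCoeff_of_not_mem_range m f h
    simp [this]

lemma H2.eval_single (k : Fin n → ℕ) (x : E) (z : Fin n → ℂ) :
    (H2.single k x).eval z = mono k z • x := by
  rw [H2.eval, tsum_eq_single k]
  · simp
  · intro l hl
    simp [H2.single_apply_ne k x hl]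

lemma H2.summable_eval (f : H2 n E) [CompleteSpace E] {z : Fin n → ℂ} (hz : z ∈ polydisc n) :
    Summable fun k => mono k z • f k :=
  Summable.of_norm (by simpa [norm_smul] using f.summable_norm hz)

lemma H2.eval_sub [CompleteSpace E] (f g : H2 n E) {z : Fin n → ℂ} (hz : z ∈ polydisc n) :
    (f - g).eval z = f.eval z - g.eval z := by
  simp only [H2.eval]
  rw [← (f.summable_eval hz).tsum_sub (g.summable_eval hz)]
  simp [smul_sub]

/-- Every element is the norm sum of its monomials. Most operator identities below are reduced to
monomials this way. -/
lemma H2.clm_ext {G : Type*} [NormedAddCommGroup G] [NormedSpace ℂ G] {A B : H2 n E →L[ℂ] G}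
    (h : ∀ k x, A (H2.single k x) = B (H2.single k x)) : A = B := by
  ext f
  have hs := f.hasSum_single
  have h1 := hs.mapL A
  have h2 := hs.mapL B
  simp only [h] at h1
  exact h1.unique h2

/-- The reproducing kernel of the Hardy space at `z`, in the direction `y`. -/
def kernel {z : Fin n → ℂ} (hz : z ∈ polydisc n) (y : E) : H2 n E :=
  ⟨fun k => conj (mono k z) • y, (memℓp_gen (p := 1) (by
    simpa [norm_smul] using (summable_norm_mono hz).mul_right ‖y‖)).of_exponent_ge (by norm_num)⟩

lemma kernel_apply {z : Fin n → ℂ} (hz : z ∈ polydisc n) (y : E) (k : Fin n → ℕ) :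
    kernel hz y k = conj (mono k z) • y := rfl

lemma inner_kernel [CompleteSpace E] {z : Fin n → ℂ} (hz : z ∈ polydisc n) (y : E) (f : H2 n E) :
    inner ℂ (kernel hz y) f = inner ℂ y (f.eval z) := by
  rw [lp.inner_eq_tsum, H2.eval]
  have := (innerSL ℂ y).map_tsum (f.summable_eval hz)
  simp only [innerSL_apply_apply] at this
  rw [this]
  refine tsum_congr fun k => ?_
  rw [kernel_apply, inner_smul_left, inner_smul_right, Complex.conj_conj]

end shift

/-! ### Backward shifts -/

section adjoint

open ContinuousLinearMap

variable {n : ℕ} {E : Type*} [NormedAddCommGroup E] [InnerProductSpace ℂ E] [CompleteSpace E]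

/-- The backward shift, the adjoint of multiplication by `z ^ m`. -/
def bshift (m : Fin n → ℕ) : H2 n E →L[ℂ] H2 n E := adjoint (shift m).toContinuousLinearMap

lemma inner_bshift_left (m : Fin n → ℕ) (f g : H2 n E) :
    inner ℂ (bshift m f) g = inner ℂ f (shift m g) := adjoint_inner_left _ _ _

lemma inner_bshift_right (m : Fin n → ℕ) (f g : H2 n E) :
    inner ℂ f (bshift m g) = inner ℂ (shift m f) g := adjoint_inner_right _ _ _

lemma bshift_apply (m : Fin n → ℕ) (f : H2 n E) (k : Fin n → ℕ) : bshift m f k = f (k + m) := by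
  refine ext_inner_left ℂ fun x => ?_
  rw [← H2.inner_single_left, inner_bshift_right, shift_single, H2.inner_single_left]

lemma bshift_shift (m : Fin n → ℕ) (f : H2 n E) : bshift m (shift m f) = f := by
  ext k
  rw [bshift_apply, shift_apply_add]

lemma bshift_comm (m l : Fin n → ℕ) (f : H2 n E) :
    bshift m (bshift l f) = bshift l (bshift m f) := by
  ext k
  simp only [bshift_apply]
  rw [add_right_comm]

lemma norm_bshift_le (m : Fin n → ℕ) (f : H2 n E) : ‖bshift m f‖ ≤ ‖f‖ := by
  refine (bshift m).le_of_opNorm_le (c := 1) ?_ f |>.trans_eq (one_mul _)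
  rw [bshift, LinearIsometryEquiv.norm_map]
  exact LinearIsometry.norm_toContinuousLinearMap_le _

/-- The exponent of the `i`-th variable. -/
abbrev basisVec (i : Fin n) : Fin n → ℕ := Pi.single i 1

/-- Double commutation: shifts in different variables commute with each other's adjoints, since
adding `m` to an exponent does not affect divisibility by `z^l`. -/
lemma bshift_shift_of_disjoint {m l : Fin n → ℕ} (h : ∀ i, m i = 0 ∨ l i = 0) (f : H2 n E) :
    bshift m (shift l f) = shift l (bshift m f) := by
  ext k
  rw [bshift_apply]
  have h1 : l ≤ k + m ↔ l ≤ k := by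
    refine forall_congr' fun i => ?_
    rcases h i with h | h <;> simp [h]
  rw [shift_apply, shift_apply, bshift_apply]
  by_cases hl : l ≤ k
  · rw [if_pos hl, if_pos (h1.2 hl), tsub_add_eq_add_tsub hl]
  · rw [if_neg hl, if_neg (fun h => hl (h1.1 h))]

lemma disjoint_basisVec {i j : Fin n} (h : i ≠ j) (k : Fin n) :
    basisVec i k = 0 ∨ basisVec j k = 0 := by
  by_cases hk : k = i
  · right; subst hk; exact Pi.single_eq_of_ne h 1
  · left; exact Pi.single_eq_of_ne hk 1

/-- A vector on which a backward shift preserves the norm is a multiple of the monomial. -/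
lemma shift_bshift_of_norm_le {m : Fin n → ℕ} {f : H2 n E} (h : ‖f‖ ≤ ‖bshift m f‖) :
    shift m (bshift m f) = f := by
  have h1 : ‖bshift m f‖ = ‖f‖ := le_antisymm (norm_bshift_le m f) h
  -- Expanding the square, both norms and the inner product equal `‖f‖²`, so the total is `1 - 2 + 1
  -- = 0` times `‖f‖²`.
  rw [← sub_eq_zero, ← norm_eq_zero, ← sq_eq_zero_iff, norm_sub_sq (𝕜 := ℂ),
    ← inner_bshift_right, inner_self_eq_norm_sq_to_K, LinearIsometry.norm_map, h1]
  norm_cast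
  ring

end adjoint

/-! ### Boundary functions and the Toeplitz identity -/

section boundary

open ContinuousLinearMap

variable {n : ℕ} {E : Type*} [NormedAddCommGroup E] [InnerProductSpace ℂ E] [CompleteSpace E]

/-- The scalar symbol `ζ ^ m`. -/
def monoSymbol (m : Fin n → ℕ) : LInfty n E where
  toFun t := mono m (torusPt t) • ContinuousLinearMap.id ℂ E
  aestronglyMeasurable' x :=
    ((continuous_mono_torusPt m).smul continuous_const).aestronglyMeasurable
  bounded' := ⟨1, Eventually.of_forall fun t => by
    rw [norm_smul, norm_mono_torusPt, one_mul]; exact norm_id_le⟩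

lemma boundary_single (k : Fin n → ℕ) (x : E) :
    H2.boundary n E (H2.single k x) = monoL2 k x :=
  (orthogonalFamily_monoL2 (n := n) (E := E)).linearIsometry_apply_single x

omit [CompleteSpace E] in
lemma monoL2_ae_eq (k : Fin n → ℕ) (x : E) :
    monoL2 k x =ᵐ[torusMeasure n] fun t => mono k (torusPt t) • x :=
  ContinuousMap.coeFn_toLp (p := 2) (𝕜 := ℂ) (torusMeasure n) (monoC k x)

lemma boundary_shift (m : Fin n → ℕ) (f : H2 n E) :
    H2.boundary n E (shift m f) = (monoSymbol m).laurent (H2.boundary n E f) := by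
  have : (H2.boundary n E).toContinuousLinearMap ∘L (shift m).toContinuousLinearMap =
      (monoSymbol m).laurent ∘L (H2.boundary n E).toContinuousLinearMap := by
    refine H2.clm_ext fun k x => ?_
    simp only [comp_apply, LinearIsometry.coe_toContinuousLinearMap, shift_single, boundary_single]
    refine Lp.ext ?_
    filter_upwards [monoL2_ae_eq (k + m) x, monoL2_ae_eq k x,
      (monoSymbol m).laurent_ae_eq (monoL2 k x)] with t h1 h2 h3
    rw [h1, h3, h2, add_comm, mono_add, mul_smul]
    rfl
  exact DFunLike.congr_fun this f

lemma boundary_shift_ae (m : Fin n → ℕ) (f : H2 n E) :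
    H2.boundary n E (shift m f) =ᵐ[torusMeasure n]
      fun t => mono m (torusPt t) • H2.boundary n E f t := by
  rw [boundary_shift]
  exact (monoSymbol m).laurent_ae_eq _

lemma LInfty.inner_toeplitz (Φ : LInfty n E) (f g : H2 n E) :
    inner ℂ g (Φ.toeplitz f) = inner ℂ (H2.boundary n E g) (Φ.laurent (H2.boundary n E f)) := by
  rw [LInfty.toeplitz, comp_apply, comp_apply, adjoint_inner_right]
  rfl

/-- Toeplitz operators satisfy `M_{z^m}* T M_{z^m} = T`. -/
lemma LInfty.bshift_toeplitz_shift (Φ : LInfty n E) (m : Fin n → ℕ) (f : H2 n E) :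
    bshift m (Φ.toeplitz (shift m f)) = Φ.toeplitz f := by
  refine ext_inner_left ℂ fun g => ?_
  rw [inner_bshift_right, Φ.inner_toeplitz, Φ.inner_toeplitz, L2.inner_def, L2.inner_def]
  refine integral_congr_ae ?_
  filter_upwards [boundary_shift_ae m f, boundary_shift_ae m g,
    Φ.laurent_ae_eq (H2.boundary n E (shift m f)), Φ.laurent_ae_eq (H2.boundary n E f)]
    with t h1 h2 h3 h4
  -- The factor `ζ^m` from each side combine to `|ζ^m|² = 1`.
  rw [h2, h3, h4, h1, map_smul, inner_smul_left, inner_smul_right, ← mul_assoc,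
    ← Complex.normSq_eq_conj_mul_self, Complex.normSq_eq_norm_sq, norm_mono_torusPt]
  simp

end boundary

/-! ### Inner products as limits over smaller tori -/

section dilation

variable {n : ℕ} {E : Type*} [NormedAddCommGroup E] [InnerProductSpace ℂ E]

lemma mono_const (k : Fin n → ℕ) (c : ℂ) : mono k (fun _ => c) = c ^ (∑ i, k i) := by
  simp [mono, Finset.prod_pow_eq_pow_sum]

lemma const_mem_polydisc {r : ℝ} (hr : r ∈ Set.Ioo (0 : ℝ) 1) :
    (fun _ => (r : ℂ)) ∈ polydisc n := fun i => by simpa [abs_of_pos hr.1] using hr.2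

lemma summable_norm_dilate {r : ℝ} (hr : r ∈ Set.Ioo (0 : ℝ) 1) (f : H2 n E) :
    Summable fun k : Fin n → ℕ => ‖(r : ℂ) ^ (∑ i, k i) • f k‖ := by
  simpa only [mono_const, norm_smul] using f.summable_norm (const_mem_polydisc hr)

/-- The dilation `f ↦ f (r ·)`. -/
def dilate {r : ℝ} (hr : r ∈ Set.Ioo (0 : ℝ) 1) (f : H2 n E) : H2 n E :=
  ⟨fun k => (r : ℂ) ^ (∑ i, k i) • f k, (memℓp_gen (p := 1) (by
    simpa using summable_norm_dilate hr f)).of_exponent_ge (by norm_num)⟩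

lemma dilate_apply {r : ℝ} (hr : r ∈ Set.Ioo (0 : ℝ) 1) (f : H2 n E) (k : Fin n → ℕ) :
    dilate hr f k = (r : ℂ) ^ (∑ i, k i) • f k := rfl

variable [CompleteSpace E]

lemma boundary_dilate_ae {r : ℝ} (hr : r ∈ Set.Ioo (0 : ℝ) 1) (f : H2 n E) :
    H2.boundary n E (dilate hr f) =ᵐ[torusMeasure n] fun t => f.eval (r • torusPt t) := by
  refine (H2.boundary_ae_eq (g := dilate hr f) (summable_norm_dilate hr f)).trans ?_
  refine Eventually.of_forall fun t => tsum_congr fun k => ?_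
  rw [dilate_apply, smul_smul, mono_smul, mul_comm]

/-- Parseval's identity for the dilations by `r`, whose coefficients are absolutely summable, so
that their boundary functions are given pointwise by `eval`. -/
lemma integral_inner_eval {r : ℝ} (hr : r ∈ Set.Ioo (0 : ℝ) 1) (f g : H2 n E) :
    ∫ t, inner ℂ (f.eval (r • torusPt t)) (g.eval (r • torusPt t)) ∂torusMeasure n =
      ∑' k : Fin n → ℕ, (r : ℂ) ^ (2 * ∑ i, k i) * inner ℂ (f k) (g k) := by
  have h : inner ℂ (H2.boundary n E (dilate hr f)) (H2.boundary n E (dilate hr g)) =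
      inner ℂ (dilate hr f) (dilate hr g) := LinearIsometry.inner_map_map _ _ _
  rw [L2.inner_def, lp.inner_eq_tsum] at h
  refine (integral_congr_ae ?_).trans (h.trans (tsum_congr fun k => ?_))
  · filter_upwards [boundary_dilate_ae hr f, boundary_dilate_ae hr g] with t h1 h2
    rw [h1, h2]
  · rw [dilate_apply, dilate_apply, inner_smul_left, inner_smul_right, map_pow, Complex.conj_ofReal,
      two_mul, pow_add, mul_assoc]

/-- The inner product of the Hardy space, through integrals over tori of radius `r → 1`. -/
lemma tendsto_integral_inner_eval (f g : H2 n E) :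
    Tendsto (fun r : ℝ => ∫ t, inner ℂ (f.eval (r • torusPt t)) (g.eval (r • torusPt t))
      ∂torusMeasure n) (𝓝[<] 1) (𝓝 (inner ℂ f g)) := by
  have hIoo : ∀ᶠ r : ℝ in 𝓝[<] 1, r ∈ Set.Ioo (0 : ℝ) 1 := Ioo_mem_nhdsLT zero_lt_one
  have hs : Summable fun k => ‖inner ℂ (f k) (g k)‖ := (lp.summable_inner (𝕜 := ℂ) f g).norm
  have he : inner ℂ f g = ∑' k, inner ℂ (f k) (g k) := lp.inner_eq_tsum f g
  rw [he]
  have h : Tendsto (fun r : ℝ => ∑' k : Fin n → ℕ, (r : ℂ) ^ (2 * ∑ i, k i) * inner ℂ (f k) (g k))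
      (𝓝[<] 1) (𝓝 (∑' k, inner ℂ (f k) (g k))) := by
    refine tendsto_tsum_of_dominated_convergence (bound := fun k => ‖inner ℂ (f k) (g k)‖)
      hs (fun k => ?_) ?_
    · have : Continuous fun r : ℝ => (r : ℂ) ^ (2 * ∑ i, k i) * inner ℂ (f k) (g k) := by fun_prop
      simpa using (this.tendsto 1).mono_left nhdsWithin_le_nhds
    · filter_upwards [hIoo] with r hr k
      rw [norm_mul, norm_pow, Complex.norm_real, Real.norm_of_nonneg hr.1.le]
      exact mul_le_of_le_one_left (norm_nonneg _) (pow_le_one₀ hr.1.le hr.2.le)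
  refine h.congr' ?_
  filter_upwards [hIoo] with r hr
  exact (integral_inner_eval hr f g).symm

end dilation

/-! ### Partial isometries, and what the Toeplitz identity adds -/

section partialIsometry

open ContinuousLinearMap

local postfix:max "†" => ContinuousLinearMap.adjoint

section abstract

variable {H : Type*} [NormedAddCommGroup H] [InnerProductSpace ℂ H] [CompleteSpace H]
  {T : H →L[ℂ] H}

lemma adjoint_apply_apply_apply (hT : ∀ f, T (T† (T f)) = T f) (f : H) :
    T† (T (T† f)) = T† f := by
  refine ext_inner_left ℂ fun g => ?_
  rw [adjoint_inner_right, ← adjoint_inner_left, adjoint_inner_right, hT, adjoint_inner_right]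

lemma inner_adjoint_apply_apply (f g : H) : inner ℂ (T† (T f)) g = inner ℂ f (T† (T g)) := by
  rw [adjoint_inner_left, adjoint_inner_right]

lemma norm_adjoint_apply_apply (hT : ∀ f, T (T† (T f)) = T f) (f : H) :
    ‖T† (T f)‖ = ‖T f‖ := by
  have h : inner ℂ (T† (T f)) (T† (T f)) = inner ℂ (T f) (T f) := by
    rw [adjoint_inner_left, hT]
  rw [inner_self_eq_norm_sq_to_K, inner_self_eq_norm_sq_to_K] at h
  exact (sq_eq_sq₀ (norm_nonneg _) (norm_nonneg _)).1 (by exact_mod_cast h)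

omit [InnerProductSpace ℂ H] [CompleteSpace H] in
lemma re_norm_sq (f : H) : RCLike.re ((‖f‖ : ℂ) ^ 2) = ‖f‖ ^ 2 := by norm_cast

lemma inner_adjoint_apply_apply_self (f : H) : inner ℂ (T† (T f)) f = (‖T f‖ : ℂ) ^ 2 := by
  rw [adjoint_inner_left, inner_self_eq_norm_sq_to_K]
  rfl

/-- Cauchy–Schwarz for `⟪T* T f, f⟫ = ‖T f‖²`, where `‖T* T f‖ = ‖T f‖`. -/
lemma norm_apply_le_of_partial (hT : ∀ f, T (T† (T f)) = T f) (f : H) : ‖T f‖ ≤ ‖f‖ := by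
  have h := norm_inner_le_norm (𝕜 := ℂ) (T† (T f)) f
  rw [inner_adjoint_apply_apply_self, norm_adjoint_apply_apply hT, norm_pow, Complex.norm_real,
    norm_norm, sq] at h
  rcases (norm_nonneg (T f)).eq_or_lt with h0 | h0
  · rw [← h0]; exact norm_nonneg f
  · exact le_of_mul_le_mul_left h h0

/-- The equality case of contractivity: `‖T* T f - f‖² = ‖f‖² - ‖T f‖²`. This is how vectors are
shown to lie in the initial space. -/
lemma adjoint_apply_apply_eq_self (hT : ∀ f, T (T† (T f)) = T f) {f : H} (h : ‖f‖ ≤ ‖T f‖) :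
    T† (T f) = f := by
  rw [← sub_eq_zero, ← norm_eq_zero, ← sq_eq_zero_iff, norm_sub_sq (𝕜 := ℂ),
    inner_adjoint_apply_apply_self, norm_adjoint_apply_apply hT,
    le_antisymm h (norm_apply_le_of_partial hT f), re_norm_sq]
  ring

lemma norm_apply_eq_of_adjoint_apply_apply {f : H} (h : T† (T f) = f) : ‖T f‖ = ‖f‖ := by
  have h1 : inner ℂ (T† (T f)) f = inner ℂ f f := by rw [h]
  rw [inner_adjoint_apply_apply_self, inner_self_eq_norm_sq_to_K] at h1
  have h2 := congrArg RCLike.re h1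
  rw [re_norm_sq] at h2
  exact (sq_eq_sq₀ (norm_nonneg _) (norm_nonneg _)).1 (h2.trans (re_norm_sq f))

/-- `T` is a partial isometry if and only if `T T* T = T`. -/
lemma isPartialIsometry_iff : IsPartialIsometry T ↔ ∀ f, T (T† (T f)) = T f := by
  have hcl : IsClosed (LinearMap.ker (T : H →ₗ[ℂ] H) : Set H) := T.isClosed_ker
  have : CompleteSpace (LinearMap.ker (T : H →ₗ[ℂ] H)) := hcl.completeSpace_coe
  have hperp : ∀ f, T† f ∈ (LinearMap.ker (T : H →ₗ[ℂ] H))ᗮ := fun f => by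
    rw [Submodule.mem_orthogonal]
    intro u hu
    rw [adjoint_inner_right, show T u = 0 from hu, inner_zero_left]
  constructor
  · intro h f
    set K := LinearMap.ker (T : H →ₗ[ℂ] H) with hK
    obtain ⟨u, hu, v, hv, rfl⟩ := K.exists_add_mem_mem_orthogonal f
    have hu' : T u = 0 := hu
    rw [map_add, hu', zero_add]
    -- `T* T v` is orthogonal to the kernel, so `T` preserves its norm. Hence `‖T* T v‖² = ⟪T v, T
    -- T* T v⟫ ≤ ‖T v‖ ‖T* T v‖`.
    have hTT : ‖T† (T v)‖ ≤ ‖T v‖ := by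
      have h2 : ‖T† (T v)‖ ^ 2 ≤ ‖T v‖ * ‖T† (T v)‖ := by
        have h3 := norm_inner_le_norm (𝕜 := ℂ) (T v) (T (T† (T v)))
        rw [← adjoint_inner_left, inner_self_eq_norm_sq_to_K, h _ (hperp _)] at h3
        simpa using h3
      rcases (norm_nonneg (T† (T v))).eq_or_lt with h0 | h0
      · rw [← h0]; exact norm_nonneg _
      · rw [sq] at h2; exact le_of_mul_le_mul_right h2 h0
    have : T† (T v) = v := by
      rw [← sub_eq_zero, ← norm_eq_zero, ← sq_eq_zero_iff]
      refine le_antisymm ?_ (sq_nonneg _)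
      rw [norm_sub_sq (𝕜 := ℂ), inner_adjoint_apply_apply_self, ← h v hv]
      rw [re_norm_sq]
      have := pow_le_pow_left₀ (norm_nonneg _) hTT 2
      linarith
    rw [this]
  · intro h f hf
    -- The difference `T* T f - f` lies both in the kernel and in its orthogonal complement, so it
    -- is zero.
    have h1 : T† (T f) - f ∈ LinearMap.ker (T : H →ₗ[ℂ] H) := by
      change T (T† (T f) - f) = 0
      rw [map_sub, h, sub_self]
    have h2 := Submodule.sub_mem _ (hperp (T f)) hf
    refine norm_apply_eq_of_adjoint_apply_apply (sub_eq_zero.1 ?_)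
    exact inner_self_eq_zero.1 (Submodule.inner_right_of_mem_orthogonal h1 h2)

end abstract

/-- A partial isometry with the Toeplitz property on the Hardy space. -/
structure IsToeplitzPartialIsometry {n : ℕ} {E : Type*} [NormedAddCommGroup E]
    [InnerProductSpace ℂ E] [CompleteSpace E] (T : H2 n E →L[ℂ] H2 n E) : Prop where
  toeplitz : ∀ m f, bshift m (T (shift m f)) = T f
  partial_isometry : ∀ f, T (T† (T f)) = T f

namespace IsToeplitzPartialIsometry

variable {n : ℕ} {E : Type*} [NormedAddCommGroup E] [InnerProductSpace ℂ E] [CompleteSpace E]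
  {T : H2 n E →L[ℂ] H2 n E}

lemma adj (hT : IsToeplitzPartialIsometry T) : IsToeplitzPartialIsometry T† where
  toeplitz m f := by
    refine ext_inner_left ℂ fun g => ?_
    rw [inner_bshift_right, adjoint_inner_right, adjoint_inner_right, ← inner_bshift_left,
      hT.toeplitz]
  partial_isometry f := by
    rw [adjoint_adjoint]
    exact adjoint_apply_apply_apply hT.partial_isometry f

/-- The lower bound comes from the Toeplitz identity, since a backward shift is a contraction; the
upper bound from the contractivity of `T`. -/
lemma apply_shift_aux (hT : IsToeplitzPartialIsometry T) (m : Fin n → ℕ) {f : H2 n E}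
    (hf : T† (T f) = f) : ‖f‖ ≤ ‖T (shift m f)‖ ∧ ‖T (shift m f)‖ ≤ ‖f‖ := by
  constructor
  · calc ‖f‖ = ‖T f‖ := (norm_apply_eq_of_adjoint_apply_apply hf).symm
      _ = ‖bshift m (T (shift m f))‖ := by rw [hT.toeplitz]
      _ ≤ _ := norm_bshift_le _ _
  · calc ‖T (shift m f)‖ ≤ ‖shift m f‖ := norm_apply_le_of_partial hT.partial_isometry _
      _ = ‖f‖ := (shift m).norm_map f

/-- The initial space is invariant under multiplication by monomials. -/
lemma adjoint_apply_shift (hT : IsToeplitzPartialIsometry T) (m : Fin n → ℕ) {f : H2 n E}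
    (hf : T† (T f) = f) : T† (T (shift m f)) = shift m f := by
  refine adjoint_apply_apply_eq_self hT.partial_isometry ?_
  rw [LinearIsometry.norm_map]
  exact (hT.apply_shift_aux m hf).1

/-- The backward shift of `T (z^m f)` is `T f`, of the same norm, so `T (z^m f)` lies in the range
of the shift and equals `z^m T f`. -/
lemma apply_shift (hT : IsToeplitzPartialIsometry T) (m : Fin n → ℕ) {f : H2 n E}
    (hf : T† (T f) = f) : T (shift m f) = shift m (T f) := by
  rw [← hT.toeplitz m f]
  refine (shift_bshift_of_norm_le ?_).symm
  rw [hT.toeplitz, norm_apply_eq_of_adjoint_apply_apply hf]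
  exact (hT.apply_shift_aux m hf).2

/-- This is `apply_shift` for `T*`, whose initial space contains `T f` for every `f`. -/
lemma shift_adjoint_apply (hT : IsToeplitzPartialIsometry T) (m : Fin n → ℕ) (f : H2 n E) :
    shift m (T† (T f)) = T† (shift m (T f)) := by
  refine (hT.adj.apply_shift m ?_).symm
  rw [adjoint_adjoint, hT.partial_isometry]

/-- The adjoint of `shift_adjoint_apply`. It needs no assumption on `f`, which lets backward shifts
pass through `T` under `T*`. -/
lemma adjoint_apply_bshift (hT : IsToeplitzPartialIsometry T) (m : Fin n → ℕ) (f : H2 n E) :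
    T† (T (bshift m f)) = T† (bshift m (T f)) := by
  refine ext_inner_left ℂ fun g => ?_
  rw [← inner_adjoint_apply_apply, inner_bshift_right, hT.shift_adjoint_apply,
    adjoint_inner_left, ← inner_bshift_right, ← adjoint_inner_right]

lemma adjoint_apply_shift_proj (hT : IsToeplitzPartialIsometry T) (m : Fin n → ℕ) (f : H2 n E) :
    T† (T (shift m (T† (T f)))) = shift m (T† (T f)) :=
  hT.adjoint_apply_shift m (by rw [hT.partial_isometry])

/-- The compressions of the backward shifts to the initial space doubly commute with the shifts. -/
lemma proj_shift_bshift (hT : IsToeplitzPartialIsometry T) {m l : Fin n → ℕ}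
    (hml : ∀ i, m i = 0 ∨ l i = 0) {f : H2 n E} (hf : T† (T f) = f) :
    T† (T (shift l (bshift m f))) = shift l (T† (T (bshift m f))) := by
  set r := bshift m f with hr
  -- The two sides of the goal have norms `‖T (z^l r)‖` and `‖T r‖` and inner product `‖T r‖²`, so
  -- equality of these norms suffices. To compare them, move the backward shift to the left of `T`,
  -- let `T` commute with `z^l` on `f`, and remove `z^l` by the Toeplitz identity for `T*`.
  have hn : ‖T (shift l r)‖ = ‖T r‖ := by
    have h : inner ℂ (T† (T (shift l r))) (shift l r) = inner ℂ (T† (T r)) r := by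
      rw [hr, ← bshift_shift_of_disjoint hml, hT.adjoint_apply_bshift, hT.apply_shift l hf,
        bshift_shift_of_disjoint hml, bshift_shift_of_disjoint hml, ← inner_bshift_left,
        hT.adj.toeplitz, hT.adjoint_apply_bshift]
    rw [inner_adjoint_apply_apply_self, inner_adjoint_apply_apply_self] at h
    exact (sq_eq_sq₀ (norm_nonneg _) (norm_nonneg _)).1 (by exact_mod_cast h)
  have hi : inner ℂ (T† (T (shift l r))) (shift l (T† (T r))) = (‖T r‖ : ℂ) ^ 2 := by
    rw [inner_adjoint_apply_apply, hT.adjoint_apply_shift_proj, LinearIsometry.inner_map_map,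
      ← inner_adjoint_apply_apply, inner_adjoint_apply_apply_self]
  rw [← sub_eq_zero, ← norm_eq_zero, ← sq_eq_zero_iff, norm_sub_sq (𝕜 := ℂ), hi,
    LinearIsometry.norm_map, norm_adjoint_apply_apply hT.partial_isometry,
    norm_adjoint_apply_apply hT.partial_isometry, hn, re_norm_sq]
  ring

/-- With `P = T* T`, this is `P S* P = P S*`, the dual form of the invariance of the initial space
under the shift `S`. The compressed backward shifts therefore commute. -/
lemma proj_bshift_proj (hT : IsToeplitzPartialIsometry T) (m : Fin n → ℕ) (f : H2 n E) :
    T† (T (bshift m (T† (T f)))) = T† (T (bshift m f)) := by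
  rw [hT.adjoint_apply_bshift, hT.partial_isometry, hT.adjoint_apply_bshift]

lemma proj_bshift_comm (hT : IsToeplitzPartialIsometry T) (m l : Fin n → ℕ) (f : H2 n E) :
    T† (T (bshift m (T† (T (bshift l f))))) = T† (T (bshift l (T† (T (bshift m f))))) := by
  rw [hT.proj_bshift_proj, hT.proj_bshift_proj, bshift_comm]

end IsToeplitzPartialIsometry

end partialIsometry

/-! ### Wold decomposition of the initial space -/

section wandering

open ContinuousLinearMap

local postfix:max "†" => ContinuousLinearMap.adjoint

variable {n : ℕ} {E : Type*} [NormedAddCommGroup E] [InnerProductSpace ℂ E] [CompleteSpace E]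

open Classical in
lemma shift_bshift_apply (m : Fin n → ℕ) (f : H2 n E) (k : Fin n → ℕ) :
    shift m (bshift m f) k = if m ≤ k then f k else 0 := by
  rw [shift_apply, bshift_apply]
  split_ifs with h
  · rw [tsub_add_cancel_of_le h]
  · rfl

/-- The backward shifts are pure. -/
lemma tendsto_norm_bshift (m : Fin n → ℕ) (i : Fin n) (f : H2 n E) :
    Tendsto (fun a : ℕ => ‖bshift (m + a • basisVec i) f‖) atTop (𝓝 0) := by
  classical
  have h : Tendsto (fun a : ℕ => ‖bshift (m + a • basisVec i) f‖ ^ 2) atTop (𝓝 0) := by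
    -- The squared norm is the part of `∑ ‖f k‖²` over the exponents `k ≥ m + a e_i`, and each `k`
    -- drops out once `a > k i`.
    have h1 : ∀ a : ℕ, ‖bshift (m + a • basisVec i) f‖ ^ 2 =
        ∑' k, ‖if m + a • basisVec i ≤ k then f k else 0‖ ^ 2 := fun a => by
      rw [← (shift (m + a • basisVec i)).norm_map, ← (H2.hasSum_sq _).tsum_eq]
      refine tsum_congr fun k => ?_
      rw [shift_bshift_apply]
    simp_rw [h1]
    rw [← tsum_zero (β := Fin n → ℕ)]
    refine tendsto_tsum_of_dominated_convergence (H2.hasSum_sq f).summable (fun k => ?_)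
      (Eventually.of_forall fun a k => ?_)
    · refine tendsto_const_nhds.congr' ?_
      filter_upwards [eventually_gt_atTop (k i)] with a ha
      rw [if_neg]
      · simp
      · intro h
        have := h i
        simp at this
        omega
    · split_ifs <;> simp
  have := h.sqrt
  simpa using this

namespace IsToeplitzPartialIsometry

/-- The wandering subspace of the initial space of `T`. -/
def wandering (T : H2 n E →L[ℂ] H2 n E) (s : Set (Fin n)) : Submodule ℂ (H2 n E) where
  carrier := {f | T† (T f) = f ∧ ∀ i ∈ s, T (bshift (basisVec i) f) = 0}
  add_mem' := fun {f g} hf hg => ⟨by simp [hf.1, hg.1], fun i hi => by simp [hf.2 i hi, hg.2 i hi]⟩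
  zero_mem' := by simp
  smul_mem' := fun c f hf => ⟨by simp [hf.1], fun i hi => by simp [hf.2 i hi]⟩

lemma mem_wandering {T : H2 n E →L[ℂ] H2 n E} {s : Set (Fin n)} {f : H2 n E} :
    f ∈ wandering T s ↔ T† (T f) = f ∧ ∀ i ∈ s, T (bshift (basisVec i) f) = 0 := Iff.rfl

lemma isClosed_wandering (T : H2 n E →L[ℂ] H2 n E) (s : Set (Fin n)) :
    IsClosed (wandering T s : Set (H2 n E)) := by
  have : (wandering T s : Set (H2 n E)) =
      {f | T† (T f) = f} ∩ ⋂ i ∈ s, {f | T (bshift (basisVec i) f) = 0} := by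
    ext f
    simp [mem_wandering]
  rw [this]
  exact (isClosed_eq (by fun_prop) continuous_id).inter
    (isClosed_biInter fun i _ => isClosed_eq (by fun_prop) continuous_const)

variable {T : H2 n E →L[ℂ] H2 n E}

/-- Cancel the common power of `z_i`. One further `z_i` remains on the left and none on the right,
where its adjoint passes through `z^{l'}` and reaches `w`. As the left vector is in the initial
space, the right one may be projected there, and the compressed backward shift kills `w`. -/
lemma inner_shift_shift_wandering (hT : IsToeplitzPartialIsometry T) {m l : Fin n → ℕ} {i : Fin n}
    (hi : l i < m i) {v w : H2 n E} (hv : v ∈ wandering T Set.univ)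
    (hw : w ∈ wandering T Set.univ) : inner ℂ (shift m v) (shift l w) = 0 := by
  classical
  obtain ⟨m', hm⟩ : ∃ m' : Fin n → ℕ, m = Pi.single i (l i) + (basisVec i + m') := by
    refine ⟨m - (Pi.single i (l i) + basisVec i), ?_⟩
    rw [← add_assoc, add_tsub_cancel_of_le]
    intro j
    by_cases hj : j = i
    · subst hj; simpa using hi
    · simp [Pi.single_eq_of_ne hj]
  obtain ⟨l', hl, hl'⟩ : ∃ l' : Fin n → ℕ, l = Pi.single i (l i) + l' ∧ l' i = 0 := by
    refine ⟨l - Pi.single i (l i), ?_, by simp⟩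
    rw [add_tsub_cancel_of_le]
    intro j
    by_cases hj : j = i
    · subst hj; simp
    · simp [Pi.single_eq_of_ne hj]
  have hdis : ∀ j, basisVec i j = 0 ∨ l' j = 0 := fun j => by
    by_cases hj : j = i
    · subst hj; exact .inr hl'
    · exact .inl (Pi.single_eq_of_ne hj 1)
  generalize (Pi.single i (l i) : Fin n → ℕ) = c at hm hl
  rw [hm, hl, shift_add, shift_add _ l', LinearIsometry.inner_map_map, shift_add,
    ← inner_bshift_right, bshift_shift_of_disjoint hdis, ← hT.adjoint_apply_shift m' hv.1,
    inner_adjoint_apply_apply, ← bshift_shift_of_disjoint hdis, bshift_shift_of_disjoint hdis,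
    hT.proj_shift_bshift hdis hw.1, hw.2 i trivial]
  simp

/-- The images of the wandering subspace under the shifts are orthogonal. -/
lemma orthogonalFamily_wandering (hT : IsToeplitzPartialIsometry T) :
    OrthogonalFamily ℂ (fun _ : Fin n → ℕ => wandering T Set.univ)
      (fun m => (shift m).comp (wandering T Set.univ).subtypeₗᵢ) := by
  intro m l hml v w
  obtain ⟨i, hi⟩ := Function.ne_iff.1 hml
  rcases hi.lt_or_gt with h | h
  · exact inner_eq_zero_symm.1 (hT.inner_shift_shift_wandering h w.2 v.2)
  · exact hT.inner_shift_shift_wandering h v.2 w.2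

lemma compress_mem_wandering (hT : IsToeplitzPartialIsometry T) {s : Set (Fin n)} (i : Fin n)
    {w : H2 n E} (hw : w ∈ wandering T s) :
    T† (T (bshift (basisVec i) w)) ∈ wandering T s := by
  refine ⟨by rw [hT.partial_isometry], fun j hj => ?_⟩
  rw [← norm_eq_zero, ← norm_adjoint_apply_apply hT.partial_isometry, hT.proj_bshift_comm,
    hw.2 j hj]
  simp

/-- One Wold step: splitting off the part of `w` divisible by `z_i` within the initial space makes
it wandering in variable `i`, and double commutation keeps it wandering in the variables of `s`. -/
lemma sub_mem_wandering (hT : IsToeplitzPartialIsometry T) {s : Set (Fin n)} (i : Fin n)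
    {w : H2 n E} (hw : w ∈ wandering T s) :
    w - shift (basisVec i) (T† (T (bshift (basisVec i) w))) ∈ wandering T (insert i s) := by
  refine ⟨by rw [map_sub, map_sub, hw.1, hT.adjoint_apply_shift_proj], fun j hj => ?_⟩
  rw [← norm_eq_zero, ← norm_adjoint_apply_apply hT.partial_isometry, norm_eq_zero]
  by_cases hji : j = i
  · subst hji
    rw [map_sub, map_sub, bshift_shift, map_sub, hT.partial_isometry, sub_self]
  · have hjs : j ∈ s := hj.resolve_left hji
    have hd := disjoint_basisVec hji
    rw [map_sub, map_sub, hw.2 j hjs, zero_sub, bshift_shift_of_disjoint hd, map_neg,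
      hT.proj_shift_bshift hd (by rw [hT.partial_isometry]), hT.proj_bshift_comm, hw.2 j hjs]
    simp

/-- By orthogonality to the remainder of the Wold step, `w` may be replaced by `z_i` times its
compressed backward shift. Each replacement moves one more `z_i` onto `f` without increasing the
norm of the vector. -/
lemma norm_inner_shift_le (hT : IsToeplitzPartialIsometry T) {s : Set (Fin n)} (i : Fin n)
    {f : H2 n E} (hf : ∀ m, ∀ w ∈ wandering T (insert i s), inner ℂ f (shift m w) = 0) (a : ℕ) :
    ∀ m, ∀ w ∈ wandering T s,
      ‖inner ℂ f (shift m w)‖ ≤ ‖bshift (m + a • basisVec i) f‖ * ‖w‖ := by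
  induction a with
  | zero =>
    intro m w _
    rw [zero_smul, add_zero, ← inner_bshift_left]
    exact norm_inner_le_norm _ _
  | succ a ih =>
    intro m w hw
    have h1 := hf m _ (hT.sub_mem_wandering i hw)
    rw [map_sub, inner_sub_right, sub_eq_zero, ← shift_add] at h1
    rw [h1, succ_nsmul', ← add_assoc]
    refine (ih _ _ (hT.compress_mem_wandering i hw)).trans ?_
    gcongr
    rw [norm_adjoint_apply_apply hT.partial_isometry]
    exact (norm_apply_le_of_partial hT.partial_isometry _).trans (norm_bshift_le _ _)

/-- The variables are removed from `s` one at a time, by letting `a → ∞` in `norm_inner_shift_le`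
and using purity. For `s` all variables, this says that the spaces `z^m W` span a dense subspace of
the initial space. -/
lemma inner_eq_zero_of_wandering (hT : IsToeplitzPartialIsometry T) (s : Finset (Fin n))
    {f : H2 n E} : (∀ m, ∀ w ∈ wandering T s, inner ℂ f (shift m w) = 0) →
    ∀ m w, T† (T w) = w → inner ℂ f (shift m w) = 0 := by
  induction s using Finset.induction_on with
  | empty => exact fun h m w hw => h m w ⟨hw, by simp⟩
  | insert i s _ ih =>
    intro h
    refine ih fun m w hw => ?_
    rw [Finset.coe_insert] at h
    rw [← norm_eq_zero]
    refine le_antisymm ?_ (norm_nonneg _)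
    have h0 : Tendsto (fun a : ℕ => ‖bshift (m + a • basisVec i) f‖ * ‖w‖) atTop (𝓝 0) := by
      simpa using (tendsto_norm_bshift m i f).mul_const ‖w‖
    exact ge_of_tendsto' h0 fun a => hT.norm_inner_shift_le i h a m w hw

/-- A partial isometry with the Toeplitz property factors through a vector-valued Hardy space, by
isometries that intertwine the shifts. -/
lemma exists_factorization {E : Type u} [NormedAddCommGroup E] [InnerProductSpace ℂ E]
    [CompleteSpace E] {T : H2 n E →L[ℂ] H2 n E} (hT : IsToeplitzPartialIsometry T) :
    ∃ (F : Type u) (_ : NormedAddCommGroup F) (_ : InnerProductSpace ℂ F) (_ : CompleteSpace F)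
      (G A : H2 n F →ₗᵢ[ℂ] H2 n E), (∀ m f, G (shift m f) = shift m (G f)) ∧
      (∀ m f, A (shift m f) = shift m (A f)) ∧
      T = G.toContinuousLinearMap ∘L (A.toContinuousLinearMap)† := by
  set W := wandering T Set.univ with hW
  have : CompleteSpace W := (isClosed_wandering T Set.univ).completeSpace_coe
  set A : H2 n W →ₗᵢ[ℂ] H2 n E := hT.orthogonalFamily_wandering.linearIsometry with hA
  have hAs : ∀ m (w : W), A (H2.single m w) = shift m (w : H2 n E) := fun m w =>
    hT.orthogonalFamily_wandering.linearIsometry_apply_single (i := m) w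
  have hAsh : ∀ m f, A (shift m f) = shift m (A f) := by
    intro m
    have : A.toContinuousLinearMap ∘L (shift m).toContinuousLinearMap =
        (shift m).toContinuousLinearMap ∘L A.toContinuousLinearMap := by
      refine H2.clm_ext fun k w => ?_
      simp only [comp_apply, LinearIsometry.coe_toContinuousLinearMap, shift_single, hAs]
      rw [← shift_add, add_comm]
    exact fun f => DFunLike.congr_fun this f
  have hAK : ∀ f, T† (T (A f)) = A f := by
    have : T† ∘L T ∘L A.toContinuousLinearMap = A.toContinuousLinearMap := by
      refine H2.clm_ext fun k w => ?_
      simp only [comp_apply, LinearIsometry.coe_toContinuousLinearMap, hAs]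
      exact hT.adjoint_apply_shift k w.2.1
    exact fun f => DFunLike.congr_fun this f
  set A' := (A.toContinuousLinearMap)† with hA'
  have hinner : ∀ f g, inner ℂ (A' f) g = inner ℂ f (A g) := fun f g => adjoint_inner_left _ _ _
  -- `A A*` is the projection onto the initial space: the difference `g` lies in that space and is
  -- orthogonal to the range of `A`, hence to itself.
  have hrange : ∀ f, A (A' f) = T† (T f) := by
    intro f
    rw [← sub_eq_zero]
    set g := A (A' f) - T† (T f) with hg
    have hgK : T† (T g) = g := by rw [hg, map_sub, map_sub, hAK, hT.partial_isometry]
    have hgA : ∀ h, inner ℂ g (A h) = 0 := by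
      intro h
      rw [hg, inner_sub_left, LinearIsometry.inner_map_map, inner_adjoint_apply_apply, hAK, hinner,
        sub_self]
    have := hT.inner_eq_zero_of_wandering Finset.univ (f := g) (fun m w hw => ?_) 0 g hgK
    · rwa [shift_zero, inner_self_eq_zero] at this
    · rw [Finset.coe_univ] at hw
      rw [← hAs m ⟨w, hw⟩]
      exact hgA _
  refine ⟨W, inferInstance, inferInstance, this,
    ⟨(T ∘L A.toContinuousLinearMap : H2 n W →L[ℂ] H2 n E), fun f => ?_⟩, A, fun m f => ?_, hAsh, ?_⟩
  · exact (norm_apply_eq_of_adjoint_apply_apply (hAK f)).trans (A.norm_map f)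
  · change T (A (shift m f)) = shift m (T (A f))
    rw [hAsh, hT.apply_shift m (hAK f)]
  · ext1 f
    change T f = T (A (A' f))
    rw [hrange, hT.partial_isometry]

end IsToeplitzPartialIsometry

end wandering

/-! ### Approximate identities and the Poisson kernel -/

section poisson

/-- Dyadic decomposition. For the least `j` with `x ≤ 2^j δ`, the `j`-th term alone suffices: either
`j = 0` and the kernel is at most `1/δ`, or `x > 2^(j-1) δ` and it is at most `δ/x²`. -/
lemma ofReal_div_le_tsum {δ x : ℝ} (hδ : 0 < δ) :
    ENNReal.ofReal (δ / (δ ^ 2 + x ^ 2)) ≤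
      ∑' j : ℕ, ENNReal.ofReal (4 * (1 / 4) ^ j / δ) *
        Set.indicator (Set.Iic (2 ^ j * δ)) 1 x := by
  classical
  have hex : ∃ j : ℕ, x ≤ 2 ^ j * δ := by
    obtain ⟨j, hj⟩ := pow_unbounded_of_one_lt (x / δ) (one_lt_two (α := ℝ))
    exact ⟨j, ((div_lt_iff₀ hδ).1 hj).le⟩
  set j := Nat.find hex with hj
  have hjx : x ≤ 2 ^ j * δ := Nat.find_spec hex
  refine le_trans ?_ (ENNReal.le_tsum j)
  rw [Set.indicator_of_mem (by exact hjx), Pi.one_apply, mul_one]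
  refine ENNReal.ofReal_le_ofReal ?_
  rw [div_le_div_iff₀ (by positivity) hδ]
  rcases Nat.eq_zero_or_pos j with h0 | h0
  · rw [h0, pow_zero]
    nlinarith [sq_nonneg x]
  · obtain ⟨i, hi⟩ : ∃ i, j = i + 1 := ⟨j - 1, by omega⟩
    have hlt : 2 ^ i * δ < x := not_le.1 (Nat.find_min hex (show i < j by omega))
    have h1 : (2 ^ i * δ) ^ 2 ≤ x ^ 2 := pow_le_pow_left₀ (by positivity) hlt.le 2
    have h2 : (1 / 4 : ℝ) ^ i * (2 ^ i) ^ 2 = 1 := by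
      rw [← pow_mul, mul_comm i, pow_mul, ← mul_pow]; norm_num
    rw [hi, pow_succ]
    have h3 : δ * δ = (1 / 4 : ℝ) ^ i * (2 ^ i * δ) ^ 2 := by
      rw [mul_pow, ← mul_assoc, h2]; ring
    calc δ * δ = (1 / 4 : ℝ) ^ i * (2 ^ i * δ) ^ 2 := h3
      _ ≤ (1 / 4 : ℝ) ^ i * (δ ^ 2 + x ^ 2) := by
        gcongr; nlinarith [sq_nonneg δ]
      _ = _ := by ring

/-- An approximate identity with kernel `δ / (δ ^ 2 + ρ ^ 2)` sends a nonnegative function with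
vanishing averages over the balls `ρ ≤ s` to zero. -/
lemma tendsto_lintegral_kernel {X : Type*} [MeasurableSpace X] {μ : Measure X} {ρ : X → ℝ}
    (hρ : Measurable ρ) {h : X → ℝ≥0∞} (hh : AEMeasurable h μ)
    (hint : ∫⁻ x, h x ∂μ ≠ ⊤)
    (havg : Tendsto (fun s : ℝ => (∫⁻ x in {x | ρ x ≤ s}, h x ∂μ) / ENNReal.ofReal s)
      (𝓝[>] 0) (𝓝 0)) :
    Tendsto (fun δ : ℝ => ∫⁻ x, ENNReal.ofReal (δ / (δ ^ 2 + ρ x ^ 2)) * h x ∂μ)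
      (𝓝[>] 0) (𝓝 0) := by
  set η : ℝ → ℝ≥0∞ := fun s => (∫⁻ x in {x | ρ x ≤ s}, h x ∂μ) / ENNReal.ofReal s with hη
  -- The averages are at most 1 at small radii by hypothesis, and at most the total integral over
  -- `s₀` at the others.
  obtain ⟨M, hM, hηM⟩ : ∃ M : ℝ≥0∞, M ≠ ⊤ ∧ ∀ s, 0 < s → η s ≤ M := by
    have h1 : ∀ᶠ s in 𝓝[>] (0 : ℝ), η s ≤ 1 := havg.eventually_le_const zero_lt_one
    obtain ⟨s₀, hs₀, hs⟩ := (mem_nhdsGT_iff_exists_Ioo_subset).1 h1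
    have hs₀ : 0 < s₀ := hs₀
    refine ⟨max 1 ((∫⁻ x, h x ∂μ) / ENNReal.ofReal s₀), ?_, fun s hs' => ?_⟩
    · refine (max_lt ENNReal.one_lt_top (ENNReal.div_lt_top hint ?_)).ne
      simpa using hs₀
    · rcases lt_or_ge s s₀ with h2 | h2
      · exact (hs ⟨hs', h2⟩).trans (le_max_left _ _)
      · refine le_trans ?_ (le_max_right _ _)
        exact ENNReal.div_le_div (setLIntegral_le_lintegral _ _) (ENNReal.ofReal_le_ofReal h2)
  -- The weight `4 · 4^{-j} / δ` times the radius `2^j δ` leaves `4 · 2^{-j}`, which is summable and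
  -- so permits dominated convergence in `j`.
  have hbound : ∀ δ : ℝ, 0 < δ → ∫⁻ x, ENNReal.ofReal (δ / (δ ^ 2 + ρ x ^ 2)) * h x ∂μ ≤
      ∑' j : ℕ, ENNReal.ofReal (4 * (1 / 2) ^ j) * η (2 ^ j * δ) := by
    intro δ hδ
    have hms : ∀ s, MeasurableSet {x | ρ x ≤ s} := fun s => measurableSet_le hρ measurable_const
    calc ∫⁻ x, ENNReal.ofReal (δ / (δ ^ 2 + ρ x ^ 2)) * h x ∂μ
        ≤ ∫⁻ x, ∑' j : ℕ, ENNReal.ofReal (4 * (1 / 4) ^ j / δ) *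
            Set.indicator {x | ρ x ≤ 2 ^ j * δ} h x ∂μ := by
          refine lintegral_mono fun x => ?_
          refine (mul_le_mul_left (ofReal_div_le_tsum hδ) (h x)).trans ?_
          rw [← ENNReal.tsum_mul_right]
          refine ENNReal.tsum_le_tsum fun j => ?_
          rw [mul_assoc]
          gcongr
          by_cases hx : ρ x ≤ 2 ^ j * δ
          · rw [Set.indicator_of_mem (by exact hx), Set.indicator_of_mem (by exact hx)]; simp
          · rw [Set.indicator_of_notMem (by exact hx)]; simp
      _ = ∑' j : ℕ, ENNReal.ofReal (4 * (1 / 4) ^ j / δ) *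
            ∫⁻ x in {x | ρ x ≤ 2 ^ j * δ}, h x ∂μ := by
          rw [lintegral_tsum fun j => (hh.indicator (hms _)).const_mul _]
          refine tsum_congr fun j => ?_
          rw [lintegral_const_mul'' _ (hh.indicator (hms _)), lintegral_indicator (hms _)]
      _ = _ := by
          refine tsum_congr fun j => ?_
          have h2 : (0 : ℝ) < 2 ^ j * δ := by positivity
          simp only [hη]
          rw [ENNReal.div_eq_inv_mul, ← mul_assoc, ← ENNReal.ofReal_inv_of_pos h2,
            ← ENNReal.ofReal_mul (by positivity)]
          congr 2
          have h4 : (1 / 4 : ℝ) ^ j = (1 / 2) ^ j * (1 / 2) ^ j := by rw [← mul_pow]; norm_num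
          have h5 : (1 / 2 : ℝ) ^ j = (2 ^ j)⁻¹ := by rw [one_div, inv_pow]
          rw [h4, h5, mul_inv]
          ring
  have hlim : Tendsto (fun δ : ℝ => ∑' j : ℕ, ENNReal.ofReal (4 * (1 / 2) ^ j) * η (2 ^ j * δ))
      (𝓝[>] 0) (𝓝 0) := by
    simp_rw [← lintegral_count]
    have h0 : (0 : ℝ≥0∞) = ∫⁻ _ : ℕ, 0 ∂Measure.count := by simp
    rw [h0]
    refine tendsto_lintegral_filter_of_dominated_convergence
      (fun j : ℕ => ENNReal.ofReal (4 * (1 / 2) ^ j) * M) (Eventually.of_forall fun _ => by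
        exact measurable_of_countable _) ?_ ?_ ?_
    · filter_upwards [self_mem_nhdsWithin] with δ hδ
      have hδ : 0 < δ := hδ
      exact Eventually.of_forall fun j => by
        gcongr
        exact hηM _ (by positivity)
    · rw [lintegral_count, ENNReal.tsum_mul_right]
      refine ENNReal.mul_ne_top ?_ hM
      rw [← ENNReal.ofReal_tsum_of_nonneg (fun j => by positivity)
        ((summable_geometric_of_lt_one (by norm_num) (by norm_num)).mul_left 4)]
      exact ENNReal.ofReal_ne_top
    · refine Eventually.of_forall fun j => ?_
      have h1 : Tendsto (fun δ : ℝ => 2 ^ j * δ) (𝓝[>] 0) (𝓝[>] 0) := by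
        refine tendsto_nhdsWithin_iff.2 ⟨?_, ?_⟩
        · have : Continuous fun δ : ℝ => 2 ^ j * δ := by fun_prop
          simpa using (this.tendsto 0).mono_left nhdsWithin_le_nhds
        · filter_upwards [self_mem_nhdsWithin] with δ hδ
          have hδ : 0 < δ := hδ
          exact (by positivity : 0 < 2 ^ j * δ)
      have h2 := ENNReal.Tendsto.const_mul (a := ENNReal.ofReal (4 * (1 / 2) ^ j)) (havg.comp h1)
        (.inr ENNReal.ofReal_ne_top)
      rwa [mul_zero] at h2
  refine tendsto_of_tendsto_of_tendsto_of_le_of_le' tendsto_const_nhds hlim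
    (Eventually.of_forall fun _ => bot_le) ?_
  filter_upwards [self_mem_nhdsWithin] with δ hδ using hbound δ hδ

/-- The Poisson kernel of the disc. -/
def poisson (r : ℝ) (s : AddCircle (1 : ℝ)) : ℝ :=
  (1 - r ^ 2) / ‖1 - (r : ℂ) * (AddCircle.toCircle s : ℂ)‖ ^ 2

/-- For the representative `|x| ≤ 1/2`, the right side is `2 |sin πx|`, and Jordan's inequality
bounds it below. -/
lemma four_mul_norm_le (s : AddCircle (1 : ℝ)) :
    4 * ‖s‖ ≤ ‖1 - (AddCircle.toCircle s : ℂ)‖ := by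
  obtain ⟨x, hx, rfl⟩ : ∃ x : ℝ, |x| ≤ 1 / 2 ∧ (x : AddCircle (1 : ℝ)) = s := by
    obtain ⟨y, rfl⟩ := QuotientAddGroup.mk_surjective s
    refine ⟨y - round y, abs_sub_round y, ?_⟩
    rw [AddCircle.coe_sub, sub_eq_self]
    exact (AddCircle.coe_eq_zero_iff 1).2 ⟨round y, by simp⟩
  have h1 : ‖(x : AddCircle (1 : ℝ))‖ = |x| :=
    (AddCircle.norm_coe_eq_abs_iff 1 one_ne_zero).2 (by simpa using hx)
  have h2 := Real.mul_abs_le_abs_sin (x := Real.pi * x) (by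
    rw [abs_mul, abs_of_pos Real.pi_pos]; nlinarith [Real.pi_pos])
  rw [abs_mul, abs_of_pos Real.pi_pos, ← mul_assoc, div_mul_cancel₀ _ Real.pi_pos.ne'] at h2
  rw [h1, AddCircle.toCircle_apply_mk, Circle.coe_exp, norm_sub_rev, mul_comm (_ : ℂ) Complex.I,
    Complex.norm_exp_I_mul_ofReal_sub_one, Real.norm_eq_abs, abs_mul, abs_two,
    show 2 * Real.pi / 1 * x / 2 = Real.pi * x by ring]
  linarith

lemma norm_one_sub_sq (r : ℝ) {z : ℂ} (hz : ‖z‖ = 1) :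
    ‖1 - r * z‖ ^ 2 = (1 - r) ^ 2 + r * ‖1 - z‖ ^ 2 := by
  have h : z.re ^ 2 + z.im ^ 2 = 1 := by
    have := Complex.sq_norm z
    rw [hz, Complex.normSq_apply] at this
    nlinarith
  rw [Complex.sq_norm, Complex.sq_norm, Complex.normSq_apply, Complex.normSq_apply]
  simp
  linear_combination (r ^ 2 - r) * h

lemma poisson_nonneg {r : ℝ} (hr : r ∈ Set.Ioo (0 : ℝ) 1) (s : AddCircle (1 : ℝ)) :
    0 ≤ poisson r s := by
  have := hr.1
  have := hr.2
  refine div_nonneg (by nlinarith) (by positivity)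

/-- Puts the Poisson kernel under the kernel of `tendsto_lintegral_kernel` with `δ = 1 - r`. The
bound `r > 1/2` keeps the angular term `r ‖1 - z‖²` above `‖s‖²`. -/
lemma poisson_le {r : ℝ} (hr : r ∈ Set.Ioo (1 / 2 : ℝ) 1) (s : AddCircle (1 : ℝ)) :
    poisson r s ≤ 2 * ((1 - r) / ((1 - r) ^ 2 + ‖s‖ ^ 2)) := by
  have h1 := hr.1
  have h2 := hr.2
  rw [poisson, norm_one_sub_sq r (Circle.norm_coe _), ← mul_div_assoc]
  have h3 : 0 < (1 - r) ^ 2 := by nlinarith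
  refine div_le_div₀ (by linarith) (by nlinarith) (by positivity) ?_
  have h4 := pow_le_pow_left₀ (by positivity) (four_mul_norm_le s) 2
  nlinarith [sq_nonneg ‖s‖]

lemma continuous_poisson {r : ℝ} (hr : r ∈ Set.Ioo (0 : ℝ) 1) : Continuous (poisson r) := by
  unfold poisson
  refine continuous_const.div₀ ?_ fun s => ?_
  · have : Continuous fun s : AddCircle (1 : ℝ) => (AddCircle.toCircle s : ℂ) :=
      continuous_subtype_val.comp AddCircle.continuous_toCircle
    fun_prop
  · rw [norm_one_sub_sq r (Circle.norm_coe _)]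
    have h1 := hr.1
    have h2 := hr.2
    have h3 : 0 < (1 - r) ^ 2 := by nlinarith
    positivity

/-- With `u = r e^{2πis}`, the kernel is `1/(1 - ū) + u/(1 - u)`. Pairing the frequencies `-m` and
`m + 1` makes the sum over `ℕ` meet every integer once. -/
lemma hasSum_poisson {r : ℝ} (hr : r ∈ Set.Ioo (0 : ℝ) 1) (s : AddCircle (1 : ℝ)) :
    HasSum (fun m : ℕ => (r : ℂ) ^ m * fourier (-(m : ℤ)) s +
      (r : ℂ) ^ (m + 1) * fourier ((m : ℤ) + 1) s) (poisson r s) := by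
  set u : ℂ := r * (AddCircle.toCircle s : ℂ) with hu
  have hun : ‖u‖ = r := by
    rw [hu, norm_mul, Circle.norm_coe, mul_one, Complex.norm_real, Real.norm_of_nonneg hr.1.le]
  have h1 := hasSum_geometric_of_norm_lt_one (show ‖u‖ < 1 by rw [hun]; exact hr.2)
  have h2 := hasSum_geometric_of_norm_lt_one (show ‖conj u‖ < 1 by
    rw [RCLike.norm_conj, hun]; exact hr.2)
  have h3 := h2.add (h1.mul_left u)
  have hf : ∀ m : ℕ, u ^ m = (r : ℂ) ^ m * fourier (m : ℤ) s := fun m => by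
    rw [hu, mul_pow, fourier_apply, natCast_zsmul, AddCircle.toCircle_nsmul, Circle.coe_pow]
  have e : (fun m : ℕ => (r : ℂ) ^ m * fourier (-(m : ℤ)) s +
      (r : ℂ) ^ (m + 1) * fourier ((m : ℤ) + 1) s) = fun m => conj u ^ m + u * u ^ m := by
    funext m
    rw [← pow_succ', hf, ← map_pow, hf, map_mul, map_pow, Complex.conj_ofReal, fourier_neg]
    push_cast
    rfl
  rw [e]
  have hne : 1 - u ≠ 0 := fun h => by
    rw [sub_eq_zero] at h
    rw [← h, norm_one] at hun
    exact hr.2.ne hun.symm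
  have hne' : 1 - conj u ≠ 0 := fun h => hne (by simpa using congrArg conj h)
  have hsq : ((‖1 - u‖ : ℂ)) ^ 2 = (1 - u) * (1 - conj u) := by
    have := Complex.mul_conj' (1 - u)
    rw [← this, map_sub, map_one]
  have hr2 : (r : ℂ) ^ 2 = u * conj u := by
    rw [Complex.mul_conj', hun]
  have hp : (poisson r s : ℂ) = (1 - conj u)⁻¹ + u * (1 - u)⁻¹ := by
    rw [poisson, ← hu]
    push_cast
    rw [hsq, hr2]
    field_simp
    ring
  rw [hp]
  exact h3

lemma integral_fourier (m : ℤ) :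
    ∫ s : AddCircle (1 : ℝ), fourier m s ∂AddCircle.haarAddCircle = if m = 0 then 1 else 0 := by
  have h := congrFun (fourierCoeff_fourier (T := 1) m) 0
  rw [fourierCoeff] at h
  simp only [neg_zero, fourier_zero, one_smul] at h
  rw [h, Pi.single_apply]
  simp [eq_comm]

/-- Integrate the series term by term: only the frequency `-d` survives. -/
lemma integral_poisson_mul_fourier {r : ℝ} (hr : r ∈ Set.Ioo (0 : ℝ) 1) (d : ℕ) :
    ∫ s, (poisson r s : ℂ) * fourier (d : ℤ) s ∂AddCircle.haarAddCircle = (r : ℂ) ^ d := by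
  set a : ℕ → AddCircle (1 : ℝ) → ℂ := fun m s => ((r : ℂ) ^ m * fourier (-(m : ℤ)) s +
      (r : ℂ) ^ (m + 1) * fourier ((m : ℤ) + 1) s) * fourier (d : ℤ) s with ha
  have hae : ∀ m, a m = fun s => (r : ℂ) ^ m * fourier (-(m : ℤ) + d) s +
      (r : ℂ) ^ (m + 1) * fourier ((m : ℤ) + 1 + d) s := fun m => by
    funext s
    rw [ha, fourier_add, fourier_add]
    ring
  have hci : ∀ m : ℤ, ∀ c : ℂ, Integrable (fun s : AddCircle (1 : ℝ) => c * fourier m s)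
      AddCircle.haarAddCircle := fun m c =>
    ((map_continuous (fourier m)).integrable_of_hasCompactSupport
      (HasCompactSupport.of_compactSpace _)).const_mul c
  have hint : ∀ m, Integrable (a m) AddCircle.haarAddCircle := fun m => by
    rw [hae]; exact (hci _ _).add (hci _ _)
  have hval : ∀ m, ∫ s, a m s ∂AddCircle.haarAddCircle = if m = d then (r : ℂ) ^ d else 0 := by
    intro m
    rw [hae, integral_add (hci _ _) (hci _ _), integral_const_mul, integral_const_mul,
      integral_fourier, integral_fourier, if_neg (show ¬(m : ℤ) + 1 + d = 0 by omega), mul_zero,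
      add_zero]
    by_cases h : m = d
    · subst h; simp
    · rw [if_neg (by omega), if_neg h, mul_zero]
  have hnorm : ∀ m s, ‖a m s‖ ≤ 2 * r ^ m := by
    intro m s
    rw [ha, norm_mul]
    have h1 : ∀ j : ℤ, ‖(fourier j : C(AddCircle (1 : ℝ), ℂ)) s‖ = 1 := fun j => Circle.norm_coe _
    rw [h1, mul_one]
    refine (norm_add_le _ _).trans ?_
    rw [norm_mul, norm_mul, h1, h1, norm_pow, norm_pow, Complex.norm_real,
      Real.norm_of_nonneg hr.1.le, pow_succ]
    have := pow_pos hr.1 m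
    nlinarith [hr.2]
  have hs : Summable fun m => ∫ s, ‖a m s‖ ∂AddCircle.haarAddCircle := by
    refine Summable.of_nonneg_of_le (fun m => integral_nonneg fun s => norm_nonneg _) (fun m => ?_)
      ((summable_geometric_of_lt_one hr.1.le hr.2).mul_left 2)
    refine (integral_mono (hint m).norm (integrable_const _) (hnorm m)).trans ?_
    simp
  have h := hasSum_integral_of_summable_integral_norm hint hs
  have h' : ∀ s, ∑' m, a m s = (poisson r s : ℂ) * fourier (d : ℤ) s := fun s =>
    ((hasSum_poisson hr s).mul_right _).tsum_eq
  simp_rw [h', hval] at h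
  refine h.unique ?_
  convert hasSum_ite_eq d ((r : ℂ) ^ d) using 1

lemma integral_poisson_sub_mul_fourier {r : ℝ} (hr : r ∈ Set.Ioo (0 : ℝ) 1) (d : ℕ)
    (s : AddCircle (1 : ℝ)) :
    ∫ x, (poisson r (x - s) : ℂ) * fourier (d : ℤ) x ∂AddCircle.haarAddCircle =
      (r : ℂ) ^ d * fourier (d : ℤ) s := by
  rw [← integral_add_right_eq_self _ s]
  simp only [add_sub_cancel_right]
  have : ∀ x, (poisson r x : ℂ) * fourier (d : ℤ) (x + s) =
      (poisson r x : ℂ) * fourier (d : ℤ) x * fourier (d : ℤ) s := fun x => by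
    simp only [fourier_apply, smul_add, AddCircle.toCircle_add, Circle.coe_mul]
    ring
  simp_rw [this]
  rw [integral_mul_const, integral_poisson_mul_fourier hr]

end poisson

/-! ### Fatou's theorem on the disc -/

section fatou

local notation "μ₁" => (AddCircle.haarAddCircle : Measure (AddCircle (1 : ℝ)))

lemma haarAddCircle_eq_volume : μ₁ = volume := by
  rw [AddCircle.volume_eq_smul_haarAddCircle]
  simp

lemma lintegral_poisson_le {r : ℝ} (hr : r ∈ Set.Ioo (1 / 2 : ℝ) 1) (h : AddCircle (1 : ℝ) → ℝ≥0∞)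
    (s : AddCircle (1 : ℝ)) :
    ∫⁻ x, ENNReal.ofReal (poisson r (x - s)) * h x ∂μ₁ ≤
      2 * ∫⁻ x, ENNReal.ofReal ((1 - r) / ((1 - r) ^ 2 + ‖x - s‖ ^ 2)) * h x ∂μ₁ := by
  rw [← lintegral_const_mul' _ _ (by simp)]
  refine lintegral_mono fun x => ?_
  rw [← mul_assoc]
  gcongr
  refine (ENNReal.ofReal_le_ofReal (poisson_le hr _)).trans_eq ?_
  rw [ENNReal.ofReal_mul (by norm_num)]
  simp

/-- **Fatou's theorem** for Poisson integrals of integrable functions on the circle. -/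
lemma ae_tendsto_integral_poisson {E : Type*} [NormedAddCommGroup E] [NormedSpace ℝ E]
    [CompleteSpace E] {g : AddCircle (1 : ℝ) → E} (hg : Integrable g μ₁) :
    ∀ᵐ s ∂μ₁, Tendsto (fun r : ℝ => ∫ x, poisson r (x - s) • g x ∂μ₁) (𝓝[<] 1) (𝓝 (g s)) := by
  have hgv : Integrable g volume := by rwa [← haarAddCircle_eq_volume]
  -- Convergence is proved at the Lebesgue points of `g`, where the averages of `‖g x - g s‖` over
  -- small balls tend to zero.
  have hav := (IsUnifLocDoublingMeasure.vitaliFamily (volume : Measure (AddCircle (1 : ℝ)))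
    1).ae_tendsto_lintegral_enorm_sub_div hgv.locallyIntegrable
  rw [haarAddCircle_eq_volume]
  filter_upwards [hav] with s hs
  rw [← haarAddCircle_eq_volume]
  have hball : Tendsto (fun δ : ℝ => Metric.closedBall s δ) (𝓝[>] 0)
      ((IsUnifLocDoublingMeasure.vitaliFamily (volume : Measure (AddCircle (1 : ℝ))) 1).filterAt
        s) := by
    refine IsUnifLocDoublingMeasure.tendsto_closedBall_filterAt _ (fun _ => s) _ tendsto_id ?_
    filter_upwards [self_mem_nhdsWithin] with δ hδ
    exact Metric.mem_closedBall_self (by simpa using (show (0 : ℝ) < δ from hδ).le)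
  have h1 := hs.comp hball
  simp only [Function.comp_def] at h1
  rw [← haarAddCircle_eq_volume] at h1
  have hK := tendsto_lintegral_kernel (μ := μ₁) (ρ := fun x => ‖x - s‖) (h := fun x => ‖g x - g s‖ₑ)
    (by fun_prop) (hg.sub (integrable_const _)).1.enorm
    (hg.sub (integrable_const (g s))).2.ne ?_
  · rw [tendsto_iff_edist_tendsto_0]
    have hlim : Tendsto (fun r : ℝ => 2 * ∫⁻ x, ENNReal.ofReal
        ((1 - r) / ((1 - r) ^ 2 + ‖x - s‖ ^ 2)) * ‖g x - g s‖ₑ ∂μ₁) (𝓝[<] 1) (𝓝 0) := by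
      have hr : Tendsto (fun r : ℝ => 1 - r) (𝓝[<] 1) (𝓝[>] 0) := by
        refine tendsto_nhdsWithin_iff.2 ⟨?_, ?_⟩
        · have : Continuous fun r : ℝ => 1 - r := by fun_prop
          simpa using (this.tendsto 1).mono_left nhdsWithin_le_nhds
        · filter_upwards [self_mem_nhdsWithin] with r hr
          exact sub_pos.2 (Set.mem_Iio.1 hr)
      have := ENNReal.Tendsto.const_mul (a := 2) (hK.comp hr) (.inr (by simp))
      rwa [mul_zero] at this
    refine tendsto_of_tendsto_of_tendsto_of_le_of_le' tendsto_const_nhds hlim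
      (Eventually.of_forall fun _ => bot_le) ?_
    filter_upwards [Ioo_mem_nhdsLT (show (1 / 2 : ℝ) < 1 by norm_num)] with r hr
    have hr' : r ∈ Set.Ioo (0 : ℝ) 1 := ⟨by linarith [hr.1], hr.2⟩
    refine le_trans ?_ (lintegral_poisson_le hr _ s)
    have hc : Continuous fun x => poisson r (x - s) :=
      (continuous_poisson hr').comp (continuous_id.sub continuous_const)
    obtain ⟨C, hC⟩ := hc.bounded_above_of_compact_support (HasCompactSupport.of_compactSpace _)
    have hi : ∀ f : AddCircle (1 : ℝ) → E, Integrable f μ₁ →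
        Integrable (fun x => poisson r (x - s) • f x) μ₁ := fun f hf =>
      hf.bdd_smul C hc.aestronglyMeasurable (Eventually.of_forall hC)
    have h1 : ∫ x, poisson r (x - s) ∂μ₁ = 1 := by
      have := integral_poisson_sub_mul_fourier hr' 0 s
      simp only [Nat.cast_zero, fourier_zero, mul_one, pow_zero] at this
      exact Complex.ofReal_injective (integral_complex_ofReal.symm.trans this)
    have h2 : ∫ x, poisson r (x - s) • g s ∂μ₁ = g s := by
      rw [integral_smul_const, h1, one_smul]
    -- The Poisson kernel has mass 1, so the error is a Poisson integral of `g x - g s`.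
    have h3 : ∫ x, poisson r (x - s) • g x ∂μ₁ - g s =
        ∫ x, poisson r (x - s) • (g x - g s) ∂μ₁ := by
      simp_rw [smul_sub]
      rw [integral_sub (hi _ hg) (hi _ (integrable_const _)), h2]
    rw [edist_eq_enorm_sub, h3]
    refine (enorm_integral_le_lintegral_enorm _).trans_eq (lintegral_congr fun x => ?_)
    rw [enorm_smul, Real.enorm_of_nonneg (poisson_nonneg hr' _)]
  · have h2 := ENNReal.Tendsto.const_mul (a := 2) h1 (.inr (by simp))
    rw [mul_zero] at h2
    refine tendsto_of_tendsto_of_tendsto_of_le_of_le' tendsto_const_nhds h2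
      (Eventually.of_forall fun _ => bot_le) ?_
    filter_upwards [self_mem_nhdsWithin] with δ hδ
    have hδ : 0 < δ := hδ
    have hset : {x | ‖x - s‖ ≤ δ} = Metric.closedBall s δ := by
      ext x; simp [dist_eq_norm]
    -- Converts division by the measure of the ball into division by its radius, at the cost of a
    -- factor 2.
    have hvol : μ₁ (Metric.closedBall s δ) ≤ 2 * ENNReal.ofReal δ := by
      rw [haarAddCircle_eq_volume, AddCircle.volume_closedBall]
      refine (ENNReal.ofReal_le_ofReal (min_le_right _ _)).trans_eq ?_
      rw [ENNReal.ofReal_mul (by norm_num)]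
      simp
    rw [hset]
    rw [ENNReal.div_eq_inv_mul, ENNReal.div_eq_inv_mul, ← mul_assoc]
    gcongr
    calc (ENNReal.ofReal δ)⁻¹ = 2 * (2 * ENNReal.ofReal δ)⁻¹ := by
          rw [ENNReal.mul_inv (by simp) (by simp), ← mul_assoc,
            ENNReal.mul_inv_cancel (by simp) (by simp), one_mul]
      _ ≤ _ := by gcongr

lemma measurePreserving_const :
    MeasurePreserving (fun x : AddCircle (1 : ℝ) => (fun _ => x : Torus 1)) μ₁
      (torusMeasure 1) := by
  have h := (measurePreserving_funUnique μ₁ (Fin 1)).symm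
  convert h using 2
  exact ((MeasurableEquiv.funUnique (Fin 1) (AddCircle (1 : ℝ))).toEquiv.symm_apply_eq.2 rfl).symm

lemma measurableEmbedding_const :
    MeasurableEmbedding (fun x : AddCircle (1 : ℝ) => (fun _ => x : Torus 1)) := by
  have h := (MeasurableEquiv.funUnique (Fin 1) (AddCircle (1 : ℝ))).symm.measurableEmbedding
  convert h using 2
  exact ((MeasurableEquiv.funUnique (Fin 1) (AddCircle (1 : ℝ))).toEquiv.symm_apply_eq.2 rfl).symm

lemma mono_one (k : Fin 1 → ℕ) (x : AddCircle (1 : ℝ)) :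
    mono k (torusPt fun _ => x) = fourier (k 0 : ℤ) x := by
  simp [mono, torusPt, fourier_apply, AddCircle.toCircle_nsmul]

variable {E : Type*} [NormedAddCommGroup E] [InnerProductSpace ℂ E] [CompleteSpace E]

/-- The scalar symbol given by a translate of the Poisson kernel. -/
def poissonSymbol {r : ℝ} (hr : r ∈ Set.Ioo (0 : ℝ) 1) (s : AddCircle (1 : ℝ)) : LInfty 1 E where
  toFun t := (poisson r (t 0 - s) : ℂ) • ContinuousLinearMap.id ℂ E
  aestronglyMeasurable' x := by
    have : Continuous fun t : Torus 1 => poisson r (t 0 - s) :=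
      (continuous_poisson hr).comp (by fun_prop)
    exact ((Complex.continuous_ofReal.comp this).smul continuous_const).aestronglyMeasurable
  bounded' := by
    obtain ⟨C, hC⟩ := (continuous_poisson hr).bounded_above_of_compact_support
      (HasCompactSupport.of_compactSpace _)
    refine ⟨C, Eventually.of_forall fun t => ?_⟩
    rw [norm_smul, Complex.norm_real]
    exact (mul_le_of_le_one_right (norm_nonneg _) ContinuousLinearMap.norm_id_le).trans (hC _)

/-- Presents the Poisson integral, paired with `y`, as a bounded functional of `G`, so that the
Poisson formula need only be checked on monomials. -/
lemma inner_poissonSymbol {r : ℝ} (hr : r ∈ Set.Ioo (0 : ℝ) 1) (s : AddCircle (1 : ℝ)) (y : E)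
    (G : L2 1 E) : inner ℂ (monoL2 0 y) ((poissonSymbol hr s).laurent G) =
      ∫ x, inner ℂ y (poisson r (x - s) • G (fun _ => x)) ∂μ₁ := by
  have h1 : inner ℂ (monoL2 0 y) ((poissonSymbol hr s).laurent G) =
      ∫ t : Torus 1, inner ℂ y (poisson r (t 0 - s) • G t) ∂torusMeasure 1 := by
    rw [L2.inner_def]
    refine integral_congr_ae ?_
    filter_upwards [monoL2_ae_eq (n := 1) 0 y, (poissonSymbol hr s).laurent_ae_eq G] with t h1 h2
    have h3 : poissonSymbol (E := E) hr s t (G t) = (poisson r (t 0 - s) : ℂ) • G t := rfl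
    have h4 : mono 0 (torusPt t) • y = y := by simp [mono]
    rw [h1, h2, h3, h4, Complex.coe_smul]
  rw [h1]
  exact (measurePreserving_const.integral_comp measurableEmbedding_const
    fun t : Torus 1 => inner ℂ y (poisson r (t 0 - s) • G t)).symm

/-- The Poisson formula for the Hardy space of the disc. -/
lemma eval_eq_integral_poisson {r : ℝ} (hr : r ∈ Set.Ioo (0 : ℝ) 1) (s : AddCircle (1 : ℝ))
    (c : H2 1 E) : c.eval (r • torusPt fun _ => s) =
      ∫ x, poisson r (x - s) • H2.boundary 1 E c (fun _ => x) ∂μ₁ := by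
  have hz := smul_torusPt_mem (n := 1) hr.1.le hr.2 (fun _ => s)
  have hint : Integrable (fun x => poisson r (x - s) • H2.boundary 1 E c (fun _ => x)) μ₁ := by
    have hc : Continuous fun x => poisson r (x - s) :=
      (continuous_poisson hr).comp (continuous_id.sub continuous_const)
    obtain ⟨C, hC⟩ := hc.bounded_above_of_compact_support (HasCompactSupport.of_compactSpace _)
    exact Integrable.bdd_smul (𝕜 := ℝ) (measurePreserving_const.integrable_comp_of_integrable
      ((Lp.memLp (H2.boundary 1 E c)).integrable (by norm_num))) C
      hc.aestronglyMeasurable (Eventually.of_forall hC)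
  refine ext_inner_left ℂ fun y => ?_
  rw [← integral_inner hint, ← inner_poissonSymbol hr, ← inner_kernel hz]
  have : innerSL ℂ (kernel hz y) = innerSL ℂ (monoL2 0 y) ∘L (poissonSymbol hr s).laurent ∘L
      (H2.boundary 1 E).toContinuousLinearMap := by
    refine H2.clm_ext fun k x => ?_
    simp only [ContinuousLinearMap.comp_apply, LinearIsometry.coe_toContinuousLinearMap,
      boundary_single, innerSL_apply_apply]
    rw [inner_kernel, H2.eval_single, inner_poissonSymbol hr, mono_smul, mono_one, inner_smul_right]
    simp only [Finset.univ_unique, Fin.default_eq_zero, Finset.sum_singleton]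
    rw [← integral_poisson_sub_mul_fourier hr, ← integral_mul_const]
    refine integral_congr_ae ?_
    filter_upwards [measurePreserving_const.quasiMeasurePreserving.ae (monoL2_ae_eq (n := 1) k x)]
      with a ha
    rw [ha, mono_one, ← Complex.coe_smul, smul_smul, inner_smul_right]
  exact DFunLike.congr_fun this c

/-- **Fatou's theorem** for the vector-valued Hardy space of the disc. -/
lemma ae_exists_tendsto_eval_one (c : H2 1 E) :
    ∀ᵐ s ∂μ₁, ∃ y, Tendsto (fun r : ℝ => c.eval (r • torusPt fun _ => s)) (𝓝[<] 1) (𝓝 y) := by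
  have hint := measurePreserving_const.integrable_comp_of_integrable
    ((Lp.memLp (H2.boundary 1 E c)).integrable (by norm_num))
  filter_upwards [ae_tendsto_integral_poisson hint] with s hs
  refine ⟨_, hs.congr' ?_⟩
  filter_upwards [Ioo_mem_nhdsLT (show (0 : ℝ) < 1 by norm_num)] with r hr
  exact (eval_eq_integral_poisson hr s c).symm

end fatou

/-! ### Fatou's theorem on the polydisc, by slicing -/

section polydiscFatou

local notation "μ₁" => (AddCircle.haarAddCircle : Measure (AddCircle (1 : ℝ)))

variable {n : ℕ}

/-- Grouping a sum over multi-indices by their degree. -/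
lemma HasSum.sum_piAntidiag {X : Type*} [AddCommGroup X] [UniformSpace X] [IsUniformAddGroup X]
    [CompleteSpace X] [T2Space X] {f : (Fin n → ℕ) → X} {a : X} (hf : HasSum f a) :
    HasSum (fun d : ℕ => ∑ k ∈ Finset.piAntidiag Finset.univ d, f k) a := by
  convert hf.tsum_fiberwise (fun k => ∑ i, k i) using 2 with d
  have h : (fun k : Fin n → ℕ => ∑ i, k i) ⁻¹' {d} =
      (Finset.piAntidiag Finset.univ d : Finset (Fin n → ℕ)) := by
    ext k
    simp
  rw [h, Finset.tsum_subtype']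

variable {E : Type*} [NormedAddCommGroup E] [InnerProductSpace ℂ E] [CompleteSpace E]

/-- The `d`-th Taylor coefficient of the slice function `z ↦ f (z ζ)`. -/
def slice (f : H2 n E) (t : Torus n) (d : ℕ) : E :=
  ∑ k ∈ Finset.piAntidiag Finset.univ d, mono k (torusPt t) • f k

omit [CompleteSpace E] in
lemma continuous_slice (f : H2 n E) (d : ℕ) : Continuous fun t => slice f t d :=
  continuous_finsetSum _ fun k _ => (continuous_mono_torusPt k).smul continuous_const

omit [CompleteSpace E] in
lemma integral_norm_sq_eq {X : Type*} [MeasurableSpace X] {μ : Measure X} (G : Lp E 2 μ) :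
    ∫ t, ‖G t‖ ^ 2 ∂μ = ‖G‖ ^ 2 := by
  have h : inner ℂ G G = ∫ t, inner ℂ (G t) (G t) ∂μ := L2.inner_def G G
  simp_rw [inner_self_eq_norm_sq_to_K] at h
  have h2 : ∫ t, ((‖G t‖ ^ 2 : ℝ) : ℂ) ∂μ = ((‖G‖ ^ 2 : ℝ) : ℂ) := by
    push_cast
    exact h.symm
  rw [integral_complex_ofReal] at h2
  exact_mod_cast h2

omit [CompleteSpace E] in
lemma integral_norm_sq_slice (f : H2 n E) (d : ℕ) :
    ∫ t, ‖slice f t d‖ ^ 2 ∂torusMeasure n = ∑ k ∈ Finset.piAntidiag Finset.univ d, ‖f k‖ ^ 2 := by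
  set S : Finset (Fin n → ℕ) := Finset.piAntidiag Finset.univ d with hS
  have h1 : ‖∑ k ∈ S, (monoL2 k (f k) : L2 n E)‖ ^ 2 = ∑ k ∈ S, ‖f k‖ ^ 2 :=
    (orthogonalFamily_monoL2 (n := n) (E := E)).norm_sum f S
  rw [← h1, ← integral_norm_sq_eq]
  refine integral_congr_ae ?_
  have h2 : ∑ k ∈ S, (monoL2 k (f k) : L2 n E) =
      ContinuousMap.toLp 2 (torusMeasure n) ℂ (∑ k ∈ S, monoC k (f k)) :=
    (map_sum (ContinuousMap.toLp (E := E) 2 (torusMeasure n) ℂ) (fun k => monoC k (f k)) S).symm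
  rw [h2]
  filter_upwards [ContinuousMap.coeFn_toLp (p := 2) (𝕜 := ℂ) (torusMeasure n)
    (∑ k ∈ S, monoC k (f k))] with t h3
  rw [h3, ContinuousMap.sum_apply]
  rfl

-- By Tonelli, the integral of the sum is `∑ ‖f k‖²`, hence finite. Almost every slice is thus in
-- the Hardy space of the disc.
omit [CompleteSpace E] in
lemma ae_summable_slice (f : H2 n E) :
    ∀ᵐ t ∂torusMeasure n, Summable fun d => ‖slice f t d‖ ^ 2 := by
  have hs := (HasSum.sum_piAntidiag (H2.hasSum_sq f)).summable
  have hi : ∀ d, ∫⁻ t, ENNReal.ofReal (‖slice f t d‖ ^ 2) ∂torusMeasure n =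
      ENNReal.ofReal (∑ k ∈ Finset.piAntidiag Finset.univ d, ‖f k‖ ^ 2) := fun d => by
    rw [← integral_norm_sq_slice, ofReal_integral_eq_lintegral_ofReal]
    · exact (((continuous_slice f d).norm.pow 2).integrable_of_hasCompactSupport
        (HasCompactSupport.of_compactSpace _))
    · exact Eventually.of_forall fun t => sq_nonneg _
  have hm : ∀ d, Measurable fun t => ENNReal.ofReal (‖slice f t d‖ ^ 2) := fun d =>
    ((continuous_slice f d).norm.pow 2).measurable.ennreal_ofReal
  have h : ∫⁻ t, ∑' d, ENNReal.ofReal (‖slice f t d‖ ^ 2) ∂torusMeasure n ≠ ⊤ := by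
    rw [lintegral_tsum fun d => (hm d).aemeasurable]
    simp_rw [hi]
    exact hs.tsum_ofReal_ne_top
  filter_upwards [ae_lt_top' (AEMeasurable.tsum fun d => (hm d).aemeasurable) h] with t ht
  have := ENNReal.summable_toReal ht.ne
  simpa [ENNReal.toReal_ofReal, sq_nonneg] using this

omit [CompleteSpace E] in
lemma mono_add_const (k : Fin n → ℕ) (t : Torus n) (s : AddCircle (1 : ℝ)) :
    mono k (torusPt (t + fun _ => s)) = fourier ((∑ i, k i : ℕ) : ℤ) s * mono k (torusPt t) := by
  simp only [mono, torusPt, Pi.add_apply, AddCircle.toCircle_add, Circle.coe_mul, mul_pow,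
    Finset.prod_mul_distrib, Finset.prod_pow_eq_pow_sum, fourier_apply, natCast_zsmul,
    AddCircle.toCircle_nsmul, Circle.coe_pow]
  ring

/-- The slice function as an element of the Hardy space of the disc. -/
def sliceH2 (f : H2 n E) (t : Torus n) (ht : Summable fun d => ‖slice f t d‖ ^ 2) : H2 1 E :=
  ⟨fun k => slice f t (k 0), memℓp_gen (by
    simpa [Function.comp_def] using ht.comp_injective (Equiv.funUnique (Fin 1) ℕ).injective)⟩

/-- Rotating all coordinates by `s` multiplies a monomial by a character that depends only on its
degree, so the series is grouped by degree. -/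
lemma eval_sliceH2 (f : H2 n E) (t : Torus n) (ht : Summable fun d => ‖slice f t d‖ ^ 2)
    {r : ℝ} (hr : r ∈ Set.Ioo (0 : ℝ) 1) (s : AddCircle (1 : ℝ)) :
    (sliceH2 f t ht).eval (r • torusPt fun _ => s) = f.eval (r • torusPt (t + fun _ => s)) := by
  have hz := smul_torusPt_mem (n := n) hr.1.le hr.2 (t + fun _ => s)
  have h1 := HasSum.sum_piAntidiag (f.summable_eval hz).hasSum
  rw [H2.eval, H2.eval, ← h1.tsum_eq, ← (Equiv.funUnique (Fin 1) ℕ).tsum_eq]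
  refine tsum_congr fun k => ?_
  change mono k (r • torusPt fun _ => s) • slice f t (k 0) = ∑ l ∈ Finset.piAntidiag _ (k 0), _
  rw [slice, Finset.smul_sum]
  refine Finset.sum_congr rfl fun l hl => ?_
  have hl' : ∑ i, l i = k 0 := by simpa using hl
  rw [mono_smul, mono_smul, mono_one, mono_add_const, hl', smul_smul]
  simp [mul_assoc]

omit [CompleteSpace E] in
/-- A measurable property that holds at almost every point of almost every diagonal line holds
almost everywhere on the torus. -/
lemma ae_of_ae_ae_add_const {p : Torus n → Prop} (hp : MeasurableSet {t | p t})
    (h : ∀ᵐ t ∂torusMeasure n, ∀ᵐ s ∂μ₁, p (t + fun _ => s)) : ∀ᵐ t ∂torusMeasure n, p t := by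
  have hm : Measurable fun x : Torus n × AddCircle (1 : ℝ) => x.1 + fun _ : Fin n => x.2 := by
    fun_prop
  -- By Fubini, some single `s` works for almost every `t`; translation invariance then removes `s`.
  have h2 := (Measure.ae_ae_comm (μ := torusMeasure n) (ν := μ₁)
    (p := fun t s => p (t + fun _ => s)) (hm hp)).1 h
  obtain ⟨s, hs⟩ := h2.exists
  exact (eventually_add_right_iff (torusMeasure n) (fun _ => s)).1 hs

lemma continuous_eval_smul_torusPt (f : H2 n E) {r : ℝ} (hr : r ∈ Set.Ioo (0 : ℝ) 1) :
    Continuous fun t : Torus n => f.eval (r • torusPt t) := by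
  unfold H2.eval
  refine continuous_tsum (u := fun k => ‖(r : ℂ) ^ (∑ i, k i) • f k‖) (fun k => ?_)
    (summable_norm_dilate hr f) fun k t => ?_
  · simp_rw [mono_smul]
    exact (continuous_const.mul (continuous_mono_torusPt k)).smul continuous_const
  · rw [mono_smul, norm_smul, norm_mul, norm_mono_torusPt, mul_one, norm_smul]

/-- Needed for the Fubini argument. By the Cauchy criterion at the scales `1/(k+1)` and `1/(m+1)`,
the set is a countable intersection of countable unions of closed sets. -/
lemma measurableSet_exists_tendsto_eval (f : H2 n E) :
    MeasurableSet {t : Torus n | ∃ y, Tendsto (fun r : ℝ => f.eval (r • torusPt t))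
      (𝓝[<] 1) (𝓝 y)} := by
  have h : {t : Torus n | ∃ y, Tendsto (fun r : ℝ => f.eval (r • torusPt t)) (𝓝[<] 1) (𝓝 y)} =
      ⋂ k : ℕ, ⋃ m : ℕ, {t | ∀ r ∈ Set.Ioo (1 - 1 / (m + 1 : ℝ)) 1,
        ∀ r' ∈ Set.Ioo (1 - 1 / (m + 1 : ℝ)) 1,
        dist (f.eval (r • torusPt t)) (f.eval (r' • torusPt t)) ≤ 1 / (k + 1 : ℝ)} := by
    ext t
    simp only [Set.mem_ofPred_eq, Set.mem_iInter, Set.mem_iUnion]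
    constructor
    · rintro ⟨y, hy⟩ k
      have hk : (0 : ℝ) < 1 / (k + 1) / 2 := by positivity
      obtain ⟨l, hl, hl'⟩ := (mem_nhdsLT_iff_exists_Ioo_subset).1
        (hy.eventually (Metric.ball_mem_nhds y hk))
      obtain ⟨m, hm⟩ := exists_nat_one_div_lt (sub_pos.2 (Set.mem_Iio.1 hl))
      have hsub : ∀ r ∈ Set.Ioo (1 - 1 / (m + 1 : ℝ)) 1,
          dist (f.eval (r • torusPt t)) y < 1 / (k + 1) / 2 := fun r hr =>
        hl' ⟨by linarith [hr.1], hr.2⟩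
      refine ⟨m, fun r hr r' hr' => ?_⟩
      have := dist_triangle_right (f.eval (r • torusPt t)) (f.eval (r' • torusPt t)) y
      linarith [hsub r hr, hsub r' hr']
    · intro h
      refine cauchy_map_iff_exists_tendsto.1 (Metric.cauchy_iff.2 ⟨inferInstance, fun ε hε => ?_⟩)
      obtain ⟨k, hk⟩ := exists_nat_one_div_lt hε
      obtain ⟨m, hm⟩ := h k
      refine ⟨_, image_mem_map (Ioo_mem_nhdsLT (show 1 - 1 / (m + 1 : ℝ) < 1 from
        sub_lt_self _ (by positivity))), ?_⟩
      rintro _ ⟨r, hr, rfl⟩ _ ⟨r', hr', rfl⟩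
      exact (hm r hr r' hr').trans_lt hk
  rw [h]
  refine MeasurableSet.iInter fun k => MeasurableSet.iUnion fun m => IsClosed.measurableSet ?_
  simp only [Set.ofPred_forall]
  have hIoo : ∀ r ∈ Set.Ioo (1 - 1 / (m + 1 : ℝ)) 1, r ∈ Set.Ioo (0 : ℝ) 1 := fun r hr => by
    refine ⟨lt_of_le_of_lt ?_ hr.1, hr.2⟩
    rw [sub_nonneg, div_le_one (by positivity)]
    linarith [(Nat.cast_nonneg m : (0 : ℝ) ≤ m)]
  refine isClosed_biInter fun r hr => isClosed_biInter fun r' hr' => isClosed_le ?_ continuous_const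
  exact (continuous_eval_smul_torusPt f (hIoo r hr)).dist
    (continuous_eval_smul_torusPt f (hIoo r' hr'))

/-- **Fatou's theorem** for the vector-valued Hardy space of the polydisc. -/
lemma ae_exists_tendsto_eval (f : H2 n E) : ∀ᵐ t ∂torusMeasure n, ∃ y,
    Tendsto (fun r : ℝ => f.eval (r • torusPt t)) (𝓝[<] 1) (𝓝 y) := by
  refine ae_of_ae_ae_add_const (measurableSet_exists_tendsto_eval f) ?_
  filter_upwards [ae_summable_slice f] with t ht
  filter_upwards [ae_exists_tendsto_eval_one (sliceH2 f t ht)] with s hs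
  obtain ⟨y, hy⟩ := hs
  refine ⟨y, hy.congr' ?_⟩
  filter_upwards [Ioo_mem_nhdsLT (show (0 : ℝ) < 1 by norm_num)] with r hr
  exact eval_sliceH2 f t ht hr s

end polydiscFatou

/-! ### Recovering functions from their values -/

section evaluation

open ContinuousLinearMap

variable {n : ℕ} {E : Type*} [NormedAddCommGroup E] [InnerProductSpace ℂ E] [CompleteSpace E]

/-- The inner product of two bounded functions in the Hardy space, through boundary values. -/
lemma inner_eq_integral_of_tendsto {f g : H2 n E} {C D : ℝ}
    (hf : ∀ z ∈ polydisc n, ‖f.eval z‖ ≤ C) (hg : ∀ z ∈ polydisc n, ‖g.eval z‖ ≤ D)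
    {φ : Torus n → ℂ} (hφ : ∀ᵐ t ∂torusMeasure n, Tendsto
      (fun r : ℝ => inner ℂ (f.eval (r • torusPt t)) (g.eval (r • torusPt t))) (𝓝[<] 1)
      (𝓝 (φ t))) :
    inner ℂ f g = ∫ t, φ t ∂torusMeasure n := by
  have hIoo : ∀ᶠ r : ℝ in 𝓝[<] 1, r ∈ Set.Ioo (0 : ℝ) 1 := Ioo_mem_nhdsLT zero_lt_one
  refine tendsto_nhds_unique (tendsto_integral_inner_eval f g)
    (tendsto_integral_filter_of_dominated_convergence (fun _ => C * D) ?_ ?_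
      (integrable_const _) hφ)
  · filter_upwards [hIoo] with r hr
    exact ((continuous_eval_smul_torusPt f hr).inner
      (continuous_eval_smul_torusPt g hr)).aestronglyMeasurable
  · filter_upwards [hIoo] with r hr
    refine Eventually.of_forall fun t => (norm_inner_le_norm _ _).trans ?_
    have hz := smul_torusPt_mem hr.1.le hr.2 t
    exact mul_le_mul (hf _ hz) (hg _ hz) (norm_nonneg _) ((norm_nonneg _).trans (hf _ hz))

/-- The norm is an integral of radial limits of the values, here with boundary function 0. -/
lemma H2.eq_zero_of_eval {f : H2 n E} (h : ∀ z ∈ polydisc n, f.eval z = 0) : f = 0 := by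
  have h1 := inner_eq_integral_of_tendsto (f := f) (g := f) (C := 0) (D := 0) (φ := 0)
    (fun z hz => by rw [h z hz, norm_zero]) (fun z hz => by rw [h z hz, norm_zero])
    (Eventually.of_forall fun t => by
      refine tendsto_const_nhds.congr' ?_
      filter_upwards [Ioo_mem_nhdsLT (show (0 : ℝ) < 1 by norm_num)] with r hr
      rw [h _ (smul_torusPt_mem hr.1.le hr.2 t), inner_zero_left]
      rfl)
  rw [← inner_self_eq_zero (𝕜 := ℂ), h1]
  simp

lemma H2.ext_eval {f g : H2 n E} (h : ∀ z ∈ polydisc n, f.eval z = g.eval z) : f = g :=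
  sub_eq_zero.1 (H2.eq_zero_of_eval fun z hz => by rw [H2.eval_sub f g hz, h z hz, sub_self])

omit [CompleteSpace E] in
/-- The square norm of the reproducing kernel at `z`. -/
lemma norm_kernel_sq {z : Fin n → ℂ} (hz : z ∈ polydisc n) (y : E) :
    ‖kernel hz y‖ ^ 2 = (∑' k : Fin n → ℕ, ‖mono k z‖ ^ 2) * ‖y‖ ^ 2 := by
  rw [← (H2.hasSum_sq _).tsum_eq, ← tsum_mul_right]
  refine tsum_congr fun k => ?_
  rw [kernel_apply, norm_smul, RCLike.norm_conj, mul_pow]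

lemma tsum_norm_mono_sq_pos {z : Fin n → ℂ} (hz : z ∈ polydisc n) :
    0 < ∑' k : Fin n → ℕ, ‖mono k z‖ ^ 2 := by
  have hs : Summable fun k : Fin n → ℕ => ‖mono k z‖ ^ 2 := by
    simpa [norm_smul, kernel_apply] using (H2.hasSum_sq (kernel hz (1 : ℂ))).summable
  exact hs.tsum_pos (fun k => sq_nonneg _) 0 (by simp [mono])

/-- Sums over boxes factor into products of geometric sums, and the boxes are cofinal among finite
sets. -/
lemma hasSum_mono {w : Fin n → ℂ} (hw : w ∈ polydisc n) :
    HasSum (fun k : Fin n → ℕ => mono k w) (∏ i, (1 - w i)⁻¹) := by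
  have hs : Summable fun k : Fin n → ℕ => mono k w := (summable_norm_mono hw).of_norm
  have hbox : Tendsto (fun N : ℕ => Fintype.piFinset fun _ : Fin n => Finset.range N) atTop
      atTop := by
    refine tendsto_atTop_finset_of_monotone (fun a b hab => ?_) fun k => ?_
    · exact Fintype.piFinset_subset _ _ fun _ => Finset.range_mono hab
    · refine ⟨Finset.univ.sup k + 1, ?_⟩
      simp only [Fintype.mem_piFinset, Finset.mem_range]
      exact fun i => Nat.lt_succ_of_le (Finset.le_sup (Finset.mem_univ i))
  have h1 := hs.hasSum.comp hbox
  have h2 : Tendsto (fun N : ℕ => ∏ i, ∑ j ∈ Finset.range N, w i ^ j) atTop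
      (𝓝 (∏ i, (1 - w i)⁻¹)) :=
    tendsto_finsetProd _ fun i _ => (hasSum_geometric_of_norm_lt_one (hw i)).tendsto_sum_nat
  have h3 : ((fun s => ∑ k ∈ s, mono k w) ∘ fun N : ℕ => Fintype.piFinset fun _ : Fin n =>
      Finset.range N) = fun N : ℕ => ∏ i, ∑ j ∈ Finset.range N, w i ^ j := by
    funext N
    simp only [Function.comp_apply, mono]
    rw [Finset.prod_univ_sum]
  rw [h3] at h1
  rw [← tendsto_nhds_unique h1 h2]
  exact hs.hasSum

omit [CompleteSpace E] in
/-- The values of the reproducing kernel are nonzero multiples of its direction. -/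
lemma exists_eval_kernel {z w : Fin n → ℂ} (hz : z ∈ polydisc n) (hw : w ∈ polydisc n) :
    ∃ c : ℂ, c ≠ 0 ∧ ∀ y : E, (kernel hw y).eval z = c • y := by
  have hzw : (fun i => z i * conj (w i)) ∈ polydisc n := fun i => by
    rw [norm_mul, RCLike.norm_conj]
    exact mul_lt_one_of_nonneg_of_lt_one_left (norm_nonneg _) (hz i) (hw i).le
  have hm : ∀ k, mono k (fun i => z i * conj (w i)) = mono k z * conj (mono k w) := fun k => by
    simp [mono, mul_pow, Finset.prod_mul_distrib]
  refine ⟨∏ i, (1 - z i * conj (w i))⁻¹, ?_, fun y => ?_⟩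
  · refine Finset.prod_ne_zero_iff.2 fun i _ => inv_ne_zero fun h => ?_
    have : ‖z i * conj (w i)‖ < 1 := hzw i
    rw [← sub_eq_zero.1 h, norm_one] at this
    exact lt_irrefl _ this
  · have h := (hasSum_mono hzw).smul_const y
    rw [H2.eval, ← h.tsum_eq]
    refine tsum_congr fun k => ?_
    rw [kernel_apply, smul_smul, hm]

end evaluation

/-! ### Inner functions and isometries commuting with the shifts -/

section symbol

open ContinuousLinearMap

local postfix:max "†" => ContinuousLinearMap.adjoint

variable {n : ℕ} {F E : Type*} [NormedAddCommGroup F] [InnerProductSpace ℂ F]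
  [CompleteSpace F] [NormedAddCommGroup E] [InnerProductSpace ℂ E] [CompleteSpace E]

lemma HInfty.eval_mulOp_single (Θ : HInfty n F E) (k : Fin n → ℕ) (x : F) {z : Fin n → ℂ}
    (hz : z ∈ polydisc n) : (Θ.mulOp (H2.single k x)).eval z = mono k z • Θ z x := by
  rw [Θ.eval_mulOp _ hz, H2.eval_single, map_smul]

lemma HInfty.mulOp_shift (Θ : HInfty n F E) (m : Fin n → ℕ) (f : H2 n F) :
    Θ.mulOp (shift m f) = shift m (Θ.mulOp f) :=
  H2.ext_eval fun z hz => by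
    rw [Θ.eval_mulOp _ hz, H2.eval_shift, H2.eval_shift, Θ.eval_mulOp _ hz, map_smul]

omit [CompleteSpace F] [CompleteSpace E] in
/-- The strong radial limits of an inner function preserve inner products. -/
lemma HInfty.IsInner.tendsto_inner {Θ : HInfty n F E} (h : Θ.IsInner) (x y : F) :
    ∀ᵐ t ∂torusMeasure n, Tendsto
      (fun r : ℝ => inner ℂ (Θ (r • torusPt t) x) (Θ (r • torusPt t) y)) (𝓝[<] 1)
      (𝓝 (inner ℂ x y)) := by
  have hn : ∀ v : F, ∀ᵐ t ∂torusMeasure n, Tendsto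
      (fun r : ℝ => (‖Θ (r • torusPt t) v‖ : ℂ) ^ 2) (𝓝[<] 1) (𝓝 ((‖v‖ : ℂ) ^ 2)) := fun v => by
    filter_upwards [h v] with t ht
    obtain ⟨w, hw, hwv⟩ := ht
    rw [← hwv]
    exact ((Complex.continuous_ofReal.tendsto _).comp hw.norm).pow 2
  -- Polarization needs only four vectors, so vector-dependent null sets do no harm.
  filter_upwards [hn (x + y), hn (x - y), hn (x - Complex.I • y), hn (x + Complex.I • y)]
    with t h1 h2 h3 h4
  rw [inner_eq_sum_norm_sq_div_four]
  simp_rw [inner_eq_sum_norm_sq_div_four]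
  simp only [map_add, map_sub, map_smul] at h1 h2 h3 h4
  exact ((h1.sub h2).add ((h3.sub h4).mul_const _)).div_const _

/-- On monomials the functions involved are bounded, so their inner products are integrals of radial
limits, which inner functions preserve. The general case follows by continuity in one argument at a
time. -/
lemma HInfty.IsInner.inner_mulOp {Θ : HInfty n F E} (h : Θ.IsInner) (f g : H2 n F) :
    inner ℂ (Θ.mulOp f) (Θ.mulOp g) = inner ℂ f g := by
  obtain ⟨C, hC⟩ := Θ.bounded'
  have hmono : ∀ (k : Fin n → ℕ), ∀ z ∈ polydisc n, ‖mono k z‖ ≤ 1 := fun k z hz => by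
    rw [mono, norm_prod]
    refine Finset.prod_le_one (fun _ _ => norm_nonneg _) fun i _ => ?_
    rw [norm_pow]
    exact pow_le_one₀ (norm_nonneg _) (hz i).le
  have hb1 : ∀ k (x : F), ∀ z ∈ polydisc n, ‖(Θ.mulOp (H2.single k x)).eval z‖ ≤ C * ‖x‖ := by
    intro k x z hz
    rw [Θ.eval_mulOp_single k x hz, norm_smul]
    exact (mul_le_of_le_one_left (norm_nonneg _) (hmono k z hz)).trans
      ((Θ z).le_of_opNorm_le (hC z hz) x)
  have hb2 : ∀ k (x : F), ∀ z ∈ polydisc n, ‖(H2.single k x).eval z‖ ≤ ‖x‖ := by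
    intro k x z hz
    rw [H2.eval_single, norm_smul]
    exact mul_le_of_le_one_left (norm_nonneg _) (hmono k z hz)
  have hIoo : ∀ᶠ r : ℝ in 𝓝[<] 1, r ∈ Set.Ioo (0 : ℝ) 1 := Ioo_mem_nhdsLT zero_lt_one
  have hlim : ∀ (k : Fin n → ℕ) (t : Torus n), Tendsto (fun r : ℝ => mono k (r • torusPt t))
      (𝓝[<] 1) (𝓝 (mono k (torusPt t))) := fun k t => by
    simp_rw [mono_smul]
    have : Continuous fun r : ℝ => (r : ℂ) ^ (∑ i, k i) * mono k (torusPt t) := by fun_prop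
    simpa using (this.tendsto 1).mono_left nhdsWithin_le_nhds
  have hsingle : ∀ k l (x y : F), inner ℂ (Θ.mulOp (H2.single k x)) (Θ.mulOp (H2.single l y)) =
      inner ℂ (H2.single k x) (H2.single l y) := by
    intro k l x y
    rw [inner_eq_integral_of_tendsto (hb1 k x) (hb1 l y) (φ := fun t =>
        conj (mono k (torusPt t)) * (mono l (torusPt t) * inner ℂ x y)),
      inner_eq_integral_of_tendsto (hb2 k x) (hb2 l y)]
    · refine Eventually.of_forall fun t => ?_
      simp_rw [H2.eval_single, inner_smul_left, inner_smul_right]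
      exact ((Complex.continuous_conj.tendsto _).comp (hlim k t)).mul
        ((hlim l t).mul tendsto_const_nhds)
    · filter_upwards [h.tendsto_inner x y] with t ht
      refine (((Complex.continuous_conj.tendsto _).comp (hlim k t)).mul
        ((hlim l t).mul ht)).congr' ?_
      filter_upwards [hIoo] with r hr
      have hz := smul_torusPt_mem hr.1.le hr.2 t
      rw [Θ.eval_mulOp_single k x hz, Θ.eval_mulOp_single l y hz, inner_smul_left,
        inner_smul_right]
      rfl
  have h1 : ∀ k (x : F) (g : H2 n F), inner ℂ (Θ.mulOp (H2.single k x)) (Θ.mulOp g) =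
      inner ℂ (H2.single k x) g := by
    intro k x g
    have : innerSL ℂ (Θ.mulOp (H2.single k x)) ∘L Θ.mulOp = innerSL ℂ (H2.single k x) :=
      H2.clm_ext fun l y => hsingle k l x y
    exact DFunLike.congr_fun this g
  have : innerSL ℂ (Θ.mulOp f) ∘L Θ.mulOp = innerSL ℂ f := H2.clm_ext fun l y => by
    simp only [comp_apply, innerSL_apply_apply]
    rw [← inner_conj_symm, h1, inner_conj_symm]
  exact DFunLike.congr_fun this g

lemma HInfty.IsInner.adjoint_mulOp_mulOp {Θ : HInfty n F E} (h : Θ.IsInner) (f : H2 n F) :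
    Θ.mulOp† (Θ.mulOp f) = f :=
  ext_inner_left ℂ fun g => by rw [adjoint_inner_right, h.inner_mulOp]

/-- The coefficients of the symbol of an isometry between Hardy spaces. -/
def symbolCoeff (A : H2 n F →ₗᵢ[ℂ] H2 n E) (k : Fin n → ℕ) : F →L[ℂ] E :=
  LinearMap.mkContinuous
    { toFun := fun x => A (H2.single 0 x) k
      map_add' := fun x y => by
        have : (H2.single 0 (x + y) : H2 n F) = H2.single 0 x + H2.single 0 y :=
          lp.single_add (E := fun _ : Fin n → ℕ => F) 2 0 x y
        rw [this, map_add]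
        rfl
      map_smul' := fun c x => by
        have : (H2.single 0 (c • x) : H2 n F) = c • H2.single 0 x :=
          lp.single_smul (E := fun _ : Fin n → ℕ => F) 2 0 c x
        rw [this, map_smul]
        rfl } 1 fun x => by
      rw [one_mul]
      refine (lp.norm_apply_le_norm (by norm_num) (A (H2.single 0 x)) k).trans_eq ?_
      rw [A.norm_map, H2.norm_single]

omit [CompleteSpace F] in
lemma summable_symbolCoeff (A : H2 n F →ₗᵢ[ℂ] H2 n E) {z : Fin n → ℂ} (hz : z ∈ polydisc n) :
    Summable fun k => mono k z • symbolCoeff A k := by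
  refine Summable.of_norm_bounded (summable_norm_mono hz) fun k => ?_
  rw [norm_smul]
  exact mul_le_of_le_one_right (norm_nonneg _) (LinearMap.mkContinuous_norm_le _ zero_le_one _)

omit [CompleteSpace F] in
lemma tsum_symbolCoeff_apply (A : H2 n F →ₗᵢ[ℂ] H2 n E) {z : Fin n → ℂ} (hz : z ∈ polydisc n)
    (x : F) : (∑' k, mono k z • symbolCoeff A k) x = (A (H2.single 0 x)).eval z :=
  (ContinuousLinearMap.apply ℂ E x).map_tsum (summable_symbolCoeff A hz)

/-- The adjoint of `A` maps kernels to kernels. Since `z^k x` is a shift of the constant `x`, the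
values of `A` on constants determine it. -/
lemma inner_kernel_intertwine {A : H2 n F →ₗᵢ[ℂ] H2 n E}
    (hA : ∀ m f, A (shift m f) = shift m (A f)) {z : Fin n → ℂ} (hz : z ∈ polydisc n) (y : E)
    (f : H2 n F) : inner ℂ (kernel hz y) (A f) =
      inner ℂ (kernel hz ((∑' k, mono k z • symbolCoeff A k)† y)) f := by
  have : innerSL ℂ (kernel hz y) ∘L A.toContinuousLinearMap =
      innerSL ℂ (kernel hz ((∑' k, mono k z • symbolCoeff A k)† y)) := by
    refine H2.clm_ext fun k x => ?_
    simp only [comp_apply, LinearIsometry.coe_toContinuousLinearMap, innerSL_apply_apply]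
    have hs : (H2.single k x : H2 n F) = shift k (H2.single 0 x) := by rw [shift_single, zero_add]
    rw [hs, hA, inner_kernel, inner_kernel, H2.eval_shift, H2.eval_shift, H2.eval_single,
      adjoint_inner_left, map_smul, map_smul, tsum_symbolCoeff_apply A hz]
    simp [mono, inner_smul_right]
  exact DFunLike.congr_fun this f

/-- The adjoint of `A` is a contraction, and kernels at the same `z` have norms proportional to
their directions with the same factor. -/
lemma norm_tsum_symbolCoeff_le {A : H2 n F →ₗᵢ[ℂ] H2 n E}
    (hA : ∀ m f, A (shift m f) = shift m (A f)) {z : Fin n → ℂ} (hz : z ∈ polydisc n) :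
    ‖∑' k, mono k z • symbolCoeff A k‖ ≤ 1 := by
  set Θ := ∑' k, mono k z • symbolCoeff A k with hΘ
  rw [← (ContinuousLinearMap.adjoint (𝕜 := ℂ) (E := F) (F := E)).norm_map Θ]
  refine opNorm_le_bound _ zero_le_one fun y => ?_
  rw [one_mul]
  set f := kernel hz (Θ† y) with hf
  have h1 : ‖f‖ ≤ ‖kernel hz y‖ := by
    have h2 := norm_inner_le_norm (𝕜 := ℂ) (kernel hz y) (A f)
    rw [inner_kernel_intertwine hA hz, ← hΘ, ← hf, inner_self_eq_norm_sq_to_K, A.norm_map] at h2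
    have h3 : ‖f‖ * ‖f‖ ≤ ‖kernel hz y‖ * ‖f‖ := by simpa [sq] using h2
    rcases (norm_nonneg f).eq_or_lt with h0 | h0
    · rw [← h0]; exact norm_nonneg _
    · exact le_of_mul_le_mul_right h3 h0
  have h2 := pow_le_pow_left₀ (norm_nonneg _) h1 2
  rw [hf, norm_kernel_sq, norm_kernel_sq] at h2
  exact (sq_le_sq₀ (norm_nonneg _) (norm_nonneg _)).1
    (le_of_mul_le_mul_left h2 (tsum_norm_mono_sq_pos hz))

/-- The symbol of an isometry between Hardy spaces that intertwines the shifts. -/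
def symbol (A : H2 n F →ₗᵢ[ℂ] H2 n E) (hA : ∀ m f, A (shift m f) = shift m (A f)) :
    HInfty n F E where
  coeff := symbolCoeff A
  summable' _ hz := summable_symbolCoeff A hz
  bounded' := ⟨1, fun _ hz => norm_tsum_symbolCoeff_le hA hz⟩

lemma mulOp_symbol (A : H2 n F →ₗᵢ[ℂ] H2 n E) (hA : ∀ m f, A (shift m f) = shift m (A f)) :
    (symbol A hA).mulOp = A.toContinuousLinearMap := by
  ext1 f
  refine H2.ext_eval fun z hz => ext_inner_left ℂ fun y => ?_
  rw [HInfty.eval_mulOp _ _ hz, ← adjoint_inner_left, ← inner_kernel hz, ← inner_kernel hz]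
  exact (inner_kernel_intertwine hA hz y f).symm

/-- Fatou's theorem for `A x` gives a radial limit `Y`. The bound on the symbol gives `‖Y‖ ≤ ‖x‖`,
and since `A` is isometric the mean of `‖Y‖²` is `‖x‖²`, so equality holds almost everywhere. -/
lemma isInner_symbol (A : H2 n F →ₗᵢ[ℂ] H2 n E) (hA : ∀ m f, A (shift m f) = shift m (A f)) :
    (symbol A hA).IsInner := by
  intro x
  set f := A (H2.single 0 x) with hf
  have hval : ∀ z ∈ polydisc n, symbol A hA z x = f.eval z := fun z hz =>
    tsum_symbolCoeff_apply A hz x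
  have hbd : ∀ z ∈ polydisc n, ‖f.eval z‖ ≤ ‖x‖ := fun z hz => by
    rw [← hval z hz]
    exact ((symbol A hA z).le_of_opNorm_le (norm_tsum_symbolCoeff_le hA hz) x).trans_eq
      (one_mul _)
  have hIoo : ∀ᶠ r : ℝ in 𝓝[<] 1, r ∈ Set.Ioo (0 : ℝ) 1 := Ioo_mem_nhdsLT zero_lt_one
  obtain ⟨Y, hY⟩ := (ae_exists_tendsto_eval f).choice
  have hYle : ∀ᵐ t ∂torusMeasure n, ‖Y t‖ ≤ ‖x‖ := by
    filter_upwards [hY] with t ht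
    refine le_of_tendsto ht.norm ?_
    filter_upwards [hIoo] with r hr using hbd _ (smul_torusPt_mem hr.1.le hr.2 t)
  -- `Y` is a pointwise choice; its measurability comes from being an a.e. limit of continuous
  -- functions along a sequence of radii.
  obtain ⟨u, -, hu, hu1⟩ := exists_seq_strictMono_tendsto' (show (0 : ℝ) < 1 by norm_num)
  have hu' : Tendsto u atTop (𝓝[<] 1) :=
    tendsto_nhdsWithin_iff.2 ⟨hu1, Eventually.of_forall fun j => (hu j).2⟩
  have hYm : AEStronglyMeasurable Y (torusMeasure n) :=
    aestronglyMeasurable_of_tendsto_ae atTop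
      (fun j => (continuous_eval_smul_torusPt f (hu j)).aestronglyMeasurable)
      (by filter_upwards [hY] with t ht using ht.comp hu')
  have hint : ∫ t, ‖Y t‖ ^ 2 ∂torusMeasure n = ‖x‖ ^ 2 := by
    have h1 := inner_eq_integral_of_tendsto hbd hbd (φ := fun t => ((‖Y t‖ ^ 2 : ℝ) : ℂ)) (by
      filter_upwards [hY] with t ht
      have := ht.inner (𝕜 := ℂ) ht
      rw [inner_self_eq_norm_sq_to_K] at this
      push_cast
      exact this)
    rw [integral_complex_ofReal, inner_self_eq_norm_sq_to_K, hf, A.norm_map, H2.norm_single] at h1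
    have h2 := congrArg Complex.re h1
    rw [Complex.ofReal_re] at h2
    rw [← h2]
    exact (re_norm_sq x)
  have hYi : Integrable (fun t => ‖Y t‖ ^ 2) (torusMeasure n) := by
    refine Integrable.of_bound (hYm.norm.pow 2) (‖x‖ ^ 2) ?_
    filter_upwards [hYle] with t ht
    rw [norm_pow, norm_norm]
    exact pow_le_pow_left₀ (norm_nonneg _) ht 2
  have hzero : ∫ t, (‖x‖ ^ 2 - ‖Y t‖ ^ 2) ∂torusMeasure n = 0 := by
    rw [integral_sub (integrable_const _) hYi, hint]
    simp
  rw [integral_eq_zero_iff_of_nonneg_ae (f := fun t => ‖x‖ ^ 2 - ‖Y t‖ ^ 2) ?_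
    ((integrable_const _).sub hYi)] at hzero
  · filter_upwards [hY, hzero] with t ht h0
    refine ⟨Y t, ht.congr' ?_, ?_⟩
    · filter_upwards [hIoo] with r hr
      exact (hval _ (smul_torusPt_mem hr.1.le hr.2 t)).symm
    · exact ((sq_eq_sq₀ (norm_nonneg _) (norm_nonneg _)).1 (sub_eq_zero.1 h0)).symm
  · filter_upwards [hYle] with t ht
    exact sub_nonneg.2 (pow_le_pow_left₀ (norm_nonneg _) ht 2)

end symbol

/-! ### The product condition -/

section productCondition

open ContinuousLinearMap

local postfix:max "†" => ContinuousLinearMap.adjoint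

variable {n : ℕ} {F E : Type*} [NormedAddCommGroup F] [InnerProductSpace ℂ F]
  [CompleteSpace F] [NormedAddCommGroup E] [InnerProductSpace ℂ E] [CompleteSpace E]

lemma update_zero_mem_polydisc {z : Fin n → ℂ} (hz : z ∈ polydisc n) (k : Fin n) :
    Function.update z k 0 ∈ polydisc n := fun i => by
  by_cases h : i = k
  · subst h; simp
  · rw [Function.update_of_ne h]; exact hz i

lemma mono_update_zero (l : Fin n → ℕ) (z : Fin n → ℂ) (k : Fin n) :
    mono l (Function.update z k 0) = if l k = 0 then mono l z else 0 := by
  split_ifs with h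
  · refine Finset.prod_congr rfl fun i _ => ?_
    by_cases hi : i = k
    · subst hi; simp [h]
    · rw [Function.update_of_ne hi]
  · exact Finset.prod_eq_zero (Finset.mem_univ k) (by simp [h])

/-- The projection of the Hardy space onto the functions that do not depend on the variable `k`. -/
def restrictZero (k : Fin n) : H2 n E →L[ℂ] H2 n E :=
  ContinuousLinearMap.id ℂ _ - (shift (basisVec k)).toContinuousLinearMap ∘L bshift (basisVec k)

lemma restrictZero_eq (k : Fin n) (f : H2 n E) :
    restrictZero k f = f - shift (basisVec k) (bshift (basisVec k) f) := rfl

lemma shift_bshift_eq (k : Fin n) (f : H2 n E) :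
    shift (basisVec k) (bshift (basisVec k) f) = f - restrictZero k f := by
  rw [restrictZero_eq, sub_sub_cancel]

lemma eval_restrictZero (k : Fin n) (f : H2 n E) (z : Fin n → ℂ) :
    (restrictZero k f).eval z = f.eval (Function.update z k 0) := by
  classical
  refine tsum_congr fun l => ?_
  have h : restrictZero k f l = f l - shift (basisVec k) (bshift (basisVec k) f) l := rfl
  have hk : basisVec k ≤ l ↔ l k ≠ 0 := by
    rw [← Nat.one_le_iff_ne_zero]
    refine ⟨fun h => by simpa using h k, fun h i => ?_⟩
    by_cases hi : i = k
    · subst hi; simpa using h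
    · rw [basisVec, Pi.single_eq_of_ne hi]; exact Nat.zero_le _
  rw [h, shift_bshift_apply, mono_update_zero]
  by_cases h0 : l k = 0 <;> simp [hk, h0]

lemma inner_restrictZero_left (k : Fin n) (f g : H2 n E) :
    inner ℂ (restrictZero k f) g = inner ℂ f (restrictZero k g) := by
  rw [restrictZero_eq, restrictZero_eq, inner_sub_left, inner_sub_right, ← inner_bshift_left,
    ← inner_bshift_right]

lemma inner_shift_bshift_left (k : Fin n) (f g : H2 n E) :
    inner ℂ (shift (basisVec k) (bshift (basisVec k) f)) g =
      inner ℂ f (shift (basisVec k) (bshift (basisVec k) g)) := by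
  rw [← inner_bshift_right, inner_bshift_left]

/-- The part of `M_Θ` that maps functions independent of the variable `k` to functions vanishing
for `z_k = 0`. -/
lemma eval_shift_bshift_mulOp_restrictZero (Θ : HInfty n F E) (k : Fin n) (g : H2 n F)
    {z : Fin n → ℂ} (hz : z ∈ polydisc n) :
    (shift (basisVec k) (bshift (basisVec k) (Θ.mulOp (restrictZero k g)))).eval z =
      (Θ z - Θ (Function.update z k 0)) (g.eval (Function.update z k 0)) := by
  have hz' := update_zero_mem_polydisc hz k
  rw [shift_bshift_eq, H2.eval_sub _ _ hz, eval_restrictZero, Θ.eval_mulOp _ hz,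
    Θ.eval_mulOp _ hz', eval_restrictZero, eval_restrictZero, Function.update_idem, sub_apply]

lemma bshift_adjoint_mulOp_shift (Θ : HInfty n F E) (m : Fin n → ℕ) (f : H2 n E) :
    bshift m (Θ.mulOp† (shift m f)) = Θ.mulOp† f := by
  refine ext_inner_left ℂ fun g => ?_
  rw [inner_bshift_right, adjoint_inner_right, Θ.mulOp_shift, LinearIsometry.inner_map_map,
    adjoint_inner_right]

/-- If `M_Γ M_Ψ*` has the Toeplitz property, then the product condition holds. -/
theorem productCondition_of_toeplitz (Γ Ψ : HInfty n F E)
    (hT : ∀ m f, bshift m (Γ.mulOp (Ψ.mulOp† (shift m f))) = Γ.mulOp (Ψ.mulOp† f)) :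
    ProductCondition Γ Ψ := by
  intro lam hlam mu hmu k
  set e := basisVec k with he
  have hmu' := update_zero_mem_polydisc hmu k
  have hlam' := update_zero_mem_polydisc hlam k
  -- `restrictZero k` is `1 - S S*` with `S` the shift in variable `k`. The terms from `1` and from
  -- `S S*` both equal `M_Γ M_Ψ* f`, the first by the Toeplitz property, the second because `M_Γ`
  -- commutes with `S`.
  have hzero : ∀ f, bshift e (Γ.mulOp (restrictZero k (Ψ.mulOp† (shift e f)))) = 0 := by
    intro f
    rw [restrictZero_eq, map_sub, map_sub, hT, bshift_adjoint_mulOp_shift, Γ.mulOp_shift,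
      bshift_shift, sub_self]
  ext1 y
  set B := Ψ mu - Ψ (Function.update mu k 0) with hB
  -- This is the adjoint of the block of `M_Ψ` from functions independent of `z_k` to multiples of
  -- `z_k`. It maps kernels to kernels, with the `k`-th coordinate of the point replaced by 0.
  have hker : restrictZero k (Ψ.mulOp† (shift e (bshift e (kernel hmu y)))) =
      kernel hmu' (B† y) := by
    refine ext_inner_right ℂ fun g => ?_
    rw [inner_restrictZero_left, adjoint_inner_left, inner_shift_bshift_left, inner_kernel,
      eval_shift_bshift_mulOp_restrictZero Ψ k g hmu, inner_kernel, adjoint_inner_left]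
  have h1 := hzero (bshift e (kernel hmu y))
  have hidem : ∀ g : H2 n F, restrictZero k (restrictZero k g) = restrictZero k g := fun g => by
    rw [restrictZero_eq k g, map_sub, restrictZero_eq k (shift _ _), bshift_shift, sub_self,
      sub_zero, restrictZero_eq]
  rw [← hidem, hker] at h1
  have h2 := eval_shift_bshift_mulOp_restrictZero Γ k (kernel hmu' (B† y)) hlam
  -- Evaluating the vanishing block product at `lam` gives `c` times the desired vector, with `c ≠
  -- 0` a value of the scalar kernel.
  obtain ⟨c, hc, hcy⟩ := exists_eval_kernel (E := F) hlam' hmu'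
  rw [h1, map_zero, hcy, map_smul] at h2
  have h3 : H2.eval (0 : H2 n E) lam = 0 := by simp [H2.eval]
  rw [h3] at h2
  exact (smul_eq_zero.1 h2.symm).resolve_left hc

end productCondition

end PolydiscToeplitz

end

/-! ### The characterization -/

open PolydiscToeplitz
theorem theorem1p4 {n : ℕ} {E : Type u} [NormedAddCommGroup E] [InnerProductSpace ℂ E]
    [CompleteSpace E] (Φ : LInfty n E) (hΦ : ¬ Φ.IsConstant) :
    (IsPartialIsometry Φ.toeplitz ↔
      ∃ (F : Type u) (_ : NormedAddCommGroup F) (_ : InnerProductSpace ℂ F) (_ : CompleteSpace F)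
        (Γ Ψ : HInfty n F E), Γ.IsInner ∧ Ψ.IsInner ∧
          Φ.toeplitz = Γ.mulOp ∘L ContinuousLinearMap.adjoint Ψ.mulOp ∧
          ProductCondition Γ Ψ) ∧
    (∀ (F : Type u) [NormedAddCommGroup F] [InnerProductSpace ℂ F] [CompleteSpace F]
      (Γ Ψ : HInfty n F E), Γ.IsInner → Ψ.IsInner →
        Φ.toeplitz = Γ.mulOp ∘L ContinuousLinearMap.adjoint Ψ.mulOp →
        ProductCondition Γ Ψ) := by
  have hprod : ∀ (F : Type u) [NormedAddCommGroup F] [InnerProductSpace ℂ F] [CompleteSpace F]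
      (Γ Ψ : HInfty n F E), Φ.toeplitz = Γ.mulOp ∘L ContinuousLinearMap.adjoint Ψ.mulOp →
        ProductCondition Γ Ψ := by
    intro F _ _ _ Γ Ψ h
    refine productCondition_of_toeplitz Γ Ψ fun m f => ?_
    have := Φ.bshift_toeplitz_shift m f
    rwa [h] at this
  refine ⟨⟨fun h => ?_, ?_⟩, fun F _ _ _ Γ Ψ _ _ h => hprod F Γ Ψ h⟩
  · obtain ⟨F, _, _, _, G, A, hG, hA, hGA⟩ := IsToeplitzPartialIsometry.exists_factorization
      ⟨Φ.bshift_toeplitz_shift, isPartialIsometry_iff.1 h⟩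
    have h1 : Φ.toeplitz = (symbol G hG).mulOp ∘L
        ContinuousLinearMap.adjoint (symbol A hA).mulOp := by
      rw [mulOp_symbol, mulOp_symbol, hGA]
    exact ⟨F, _, _, _, symbol G hG, symbol A hA, isInner_symbol G hG, isInner_symbol A hA, h1,
      hprod F _ _ h1⟩
  · rintro ⟨F, _, _, _, Γ, Ψ, hΓ, hΨ, h, -⟩
    -- `T T* T = M_Γ M_Ψ* M_Ψ M_Γ* M_Γ M_Ψ*` collapses by `M_Γ* M_Γ = 1` and `M_Ψ* M_Ψ = 1`.
    refine isPartialIsometry_iff.2 fun f => ?_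
    rw [h, ContinuousLinearMap.adjoint_comp, ContinuousLinearMap.adjoint_adjoint]
    simp only [ContinuousLinearMap.comp_apply]
    rw [hΓ.adjoint_mulOp_mulOp, hΨ.adjoint_mulOp_mulOp]
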